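/- Let $K$ be a field of characteristic $0$, let $n\ge 3$ be an integer and put $d=\frac{n(n-1)}2$. To a coefficient vector $c=(c_{j,k,m})\in K^{dn^2}$ ($1\le j\le d$, $1\le k,m\le n$) associate the quadratic algebra $R=K\langle x_1,\dots,x_n\rangle/I$, where $K\langle x_1,\dots,x_n\rangle$ is the free associative algebra, graded by $\deg x_i=1$, and $I$ is the two-sided ideal generated by $f_j=\sum_{k,m=1}^n c_{j,k,m}x_kx_m$, $1\le j\le d$. Let $R_q$ be the degree $q$ component of $R$ and $H_R(t)=\sum_{q\ge 0}(\dim_K R_q)\,t^q$ its Hilbert series. Then there is a dense Zariski open subset $U$ of $K^{dn^2}$ such that for every $c\in U$ the algebra $R$ is finite dimensional, with Hilbert series and dimension $$H_R(t)=\begin{cases}1+nt+\frac{n(n+1)}2t^2+n^2t^3 & (n\ge 5),\\ 1+4t+10t^2+16t^3+4t^4 & (n=4),\\ 1+3t+6t^2+9t^3+9t^4 & (n=3),\end{cases}\qquad \dim_K R=\begin{cases}\frac{3n(n+1)+2}2 & (n\ge 5),\\ 35 & (n=4),\\ 28 & (n=3).\end{cases}$$ -/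

import Mathlib

noncomputable section

namespace QuadAlg

/-- The Zariski topology on the affine space `K^σ`: the topology generated by the
non-vanishing sets `{x | p(x) ≠ 0}` of polynomials `p`. -/
abbrev zariskiTopology (K σ : Type*) [Field K] : TopologicalSpace (σ → K) :=
  TopologicalSpace.generateFrom
    (Set.range fun p : MvPolynomial σ K => {x : σ → K | MvPolynomial.eval x p ≠ 0})

/-- The degree `q` component `F_q(n, K)` of the free algebra `K⟨x_1, …, x_n⟩`:
the span of the monomials of length `q`. -/
def freeComponent (K : Type*) [Field K] (n q : ℕ) : Submodule K (FreeAlgebra K (Fin n)) :=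
  Submodule.span K
    (Set.range fun w : Fin q → Fin n => (List.ofFn fun i => FreeAlgebra.ι K (w i)).prod)

/-- The space `K^{d n²}` of coefficient vectors `(c_{j,k,m})` of `d` homogeneous quadratic
relations in `n` generators. -/
abbrev Coeffs (K : Type*) (n d : ℕ) : Type _ := Fin d × Fin n × Fin n → K

/-- A property of quadratic `K`-algebras with `n` generators and `d` relations (given as a
property of coefficient vectors) holds generically if the set of coefficient vectors that have it
contains a dense Zariski open set. -/
def Generic (K : Type*) [Field K] (n d : ℕ) (P : Coeffs K n d → Prop) : Prop :=
  ∃ U : Set (Coeffs K n d),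
    @IsOpen _ (zariskiTopology K (Fin d × Fin n × Fin n)) U ∧
    @Dense _ (zariskiTopology K (Fin d × Fin n × Fin n)) U ∧
    ∀ c ∈ U, P c

variable {K : Type*} [Field K] {n d : ℕ}

/-- The `j`-th relation `f_j = ∑_{k,m} c_{j,k,m} x_k x_m`. -/
def relation (c : Coeffs K n d) (j : Fin d) : FreeAlgebra K (Fin n) :=
  ∑ k : Fin n, ∑ m : Fin n, c (j, k, m) • (FreeAlgebra.ι K k * FreeAlgebra.ι K m)

/-- The two-sided ideal `I` generated by the relations `f_1, …, f_d`. -/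
def relationIdeal (c : Coeffs K n d) : TwoSidedIdeal (FreeAlgebra K (Fin n)) :=
  TwoSidedIdeal.span (Set.range (relation c))

/-- The quadratic algebra `R = K⟨x_1, …, x_n⟩ / I` with coefficient vector `c`. -/
abbrev QuadraticAlgebra (c : Coeffs K n d) : Type _ := (relationIdeal c).ringCon.Quotient

/-- The degree `q` component `R_q` of `R`, that is, the image `F_q / (I ∩ F_q)` of `F_q` in `R`. -/
def component (c : Coeffs K n d) (q : ℕ) : Submodule K (QuadraticAlgebra c) :=
  (freeComponent K n q).map ((relationIdeal c).ringCon.mkₐ (α := K)).toLinearMap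

/-- The Hilbert series `H_R(t) = ∑_q (dim_K R_q) t^q`. Each `R_q` is spanned by finitely many
monomials, so that `finrank` is its true dimension. -/
def hilbertSeries (c : Coeffs K n d) : PowerSeries ℤ :=
  PowerSeries.mk fun q => (Module.finrank K (component c q) : ℤ)

end QuadAlg

end

/-!
The lower bounds come from the exact sequence `R_q^d → R_{q+1}^n → R_{q+2} → 0`, in which the
second map multiplies by the generators and the first one by the coefficients of the relations
(`golod_shafarevich`). For `d = n(n-1)/2` it gives `dim R_2 ≥ n(n+1)/2`, `dim R_3 ≥ n²`, and
`dim R_4 ≥ 4` or `9` for `n = 4` or `3`; it also shows that a minimal `R_3` forces `dim R_2` to be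
minimal, and that for `n = 3` the vanishing of `R_5` forces `dim R_4 = 9`.

For the upper bounds, the degree `q` part of the ideal of relations is spanned by the products
`u f_j v` of that degree, which depend linearly on the coefficients. Hence `dim R_q` can only drop
off the zero set of a nonzero polynomial (`exists_polynomial_finrank_component_le`). Since
the product of finitely many nonzero polynomials is nonzero, it suffices to give, for
each degree `q` separately, one algebra in which `R_q` is small:

* `dim R_3 ≤ n²` for all `n`: split the letters evenly into `x_i` and `y_j` and take relations
  `x_i y_j = 0` and `x_i x_j = y_i y_j`, of which there are just `n(n-1)/2` if the last `y_j` is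
  left out of the latter (`exists_finrank_component_three_le`).
* `R_4 = 0` for `n ≥ 5`: a semigroup presentation (relations `ab = ce` or `ab = 0` between letters)
  in which all words of length four vanish stays such if each letter `a` is replaced by letters
  `a(0), …, a(s_a - 1)`, with relations `a(i) b(j) = c(i) e(j)` and out-of-range letters read
  as `0` (`exists_finrank_component_le`). A single presentation with six letters serves all
  `n ≥ 5` for suitable sizes `s_a` (`exists_finrank_component_four_le`).
* `dim R_4 ≤ 4` and `R_5 = 0` for `n = 4`: two semigroup presentations with four letters.
* `R_5 = 0` for `n = 3`: the relations `x₂x₁ = -x₀x₂`, `x₀x₁ = 0`, `x₂² = x₀² - x₁²` have this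
  property, by a Gröbner basis computation that divides by `2` (`prod_five_eq_zero`).

That a semigroup presentation reduces all words of a given length to `0` or to given words is
decided by a graph search on the words, proved sound in `reduces_induction`.
-/

noncomputable section

namespace QuadAlg

open Module

variable {K : Type*} [Field K] {n d : ℕ}

/-! ### Words in the free algebra -/

/-- The monomial of the free algebra spelled by a list of letters. -/
def word (K : Type*) [Field K] {n : ℕ} (l : List (Fin n)) : FreeAlgebra K (Fin n) :=
  (l.map (FreeAlgebra.ι K)).prod

@[simp] theorem word_nil : word K ([] : List (Fin n)) = 1 := rfl

theorem word_append (l l' : List (Fin n)) : word K (l ++ l') = word K l * word K l' := by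
  simp [word]

theorem word_concat (l : List (Fin n)) (i : Fin n) :
    word K (l ++ [i]) = word K l * FreeAlgebra.ι K i := by
  simp [word]

/-- The words form a basis of the free algebra. -/
def wordBasis (K : Type*) [Field K] (n : ℕ) : Basis (List (Fin n)) K (FreeAlgebra K (Fin n)) :=
  (FreeAlgebra.basisFreeMonoid K (Fin n)).reindex FreeMonoid.toList

@[simp] theorem wordBasis_apply (l : List (Fin n)) : wordBasis K n l = word K l := by
  have h : FreeAlgebra.equivMonoidAlgebraFreeMonoid (word K l)
      = MonoidAlgebra.single (FreeMonoid.ofList l) (1 : K) := by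
    induction l with
    | nil => simp [word]; rfl
    | cons a l ih =>
      have : word K (a :: l) = FreeAlgebra.ι K a * word K l := by simp [word]
      rw [this, map_mul, ih]
      simp [FreeAlgebra.equivMonoidAlgebraFreeMonoid, MonoidAlgebra.of_apply,
        MonoidAlgebra.single_mul_single]
  simp only [wordBasis, Basis.reindex_apply, FreeAlgebra.basisFreeMonoid, Basis.map_apply]
  rw [LinearEquiv.symm_apply_eq]
  simp only [LinearEquiv.trans_apply, AlgEquiv.toLinearEquiv_apply, h]
  simp

theorem word_induction {P : FreeAlgebra K (Fin n) → Prop} (a : FreeAlgebra K (Fin n))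
    (hw : ∀ l, P (word K l)) (h0 : P 0) (hadd : ∀ a b, P a → P b → P (a + b))
    (hsmul : ∀ (r : K) a, P a → P (r • a)) : P a := by
  have ha : a ∈ Submodule.span K (Set.range (wordBasis K n)) := by
    rw [(wordBasis K n).span_eq]; trivial
  induction ha using Submodule.span_induction with
  | mem x hx => obtain ⟨l, rfl⟩ := hx; simpa using hw l
  | zero => exact h0
  | add x y _ _ hx hy => exact hadd _ _ hx hy
  | smul r x _ hx => exact hsmul _ _ hx

/-- The projection of the free algebra onto its degree `q` component. -/
def proj (K : Type*) [Field K] (n q : ℕ) :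
    FreeAlgebra K (Fin n) →ₗ[K] FreeAlgebra K (Fin n) :=
  (wordBasis K n).constr K fun l => if l.length = q then word K l else 0

theorem proj_word (q : ℕ) (l : List (Fin n)) :
    proj K n q (word K l) = if l.length = q then word K l else 0 := by
  rw [← wordBasis_apply, proj, Basis.constr_basis]
  simp

/-- Right division by `x_i`: the linear map sending `a x_i` to `a`, and killing `1` and all
words that end in another letter. -/
def rightDiv (K : Type*) [Field K] {n : ℕ} (i : Fin n) :
    FreeAlgebra K (Fin n) →ₗ[K] FreeAlgebra K (Fin n) :=
  (wordBasis K n).constr K fun l => if l.getLast? = some i then word K l.dropLast else 0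

theorem rightDiv_word (i : Fin n) (l : List (Fin n)) :
    rightDiv K i (word K l) = if l.getLast? = some i then word K l.dropLast else 0 := by
  rw [← wordBasis_apply, rightDiv, Basis.constr_basis]

theorem rightDiv_mul_ι (i m : Fin n) (a : FreeAlgebra K (Fin n)) :
    rightDiv K i (a * FreeAlgebra.ι K m) = if m = i then a else 0 := by
  induction a using word_induction with
  | hw l => rw [← word_concat, rightDiv_word]; simp
  | h0 => simp
  | hadd a b ha hb => rw [add_mul, map_add, ha, hb]; split_ifs <;> simp
  | hsmul r a ha => rw [smul_mul_assoc, map_smul, ha]; split_ifs <;> simp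

theorem proj_mul_ι (q : ℕ) (m : Fin n) (a : FreeAlgebra K (Fin n)) :
    proj K n (q + 1) (a * FreeAlgebra.ι K m) = proj K n q a * FreeAlgebra.ι K m := by
  induction a using word_induction with
  | hw l => rw [← word_concat, proj_word, proj_word, word_concat]; split_ifs <;> simp_all
  | h0 => simp
  | hadd a b ha hb => rw [add_mul, map_add, ha, hb, map_add, add_mul]
  | hsmul r a ha => rw [smul_mul_assoc, map_smul, ha, map_smul, smul_mul_assoc]

theorem freeComponent_eq (q : ℕ) :
    freeComponent K n q = Submodule.span K (Set.range fun w : Fin q → Fin n =>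
      word K (List.ofFn w)) := by
  unfold freeComponent word
  congr 2
  funext w
  simp [List.map_ofFn, Function.comp_def]

theorem word_mem_freeComponent {q : ℕ} {l : List (Fin n)} (hl : l.length = q) :
    word K l ∈ freeComponent K n q := by
  subst hl
  rw [freeComponent_eq]
  exact Submodule.subset_span ⟨l.get, by simp⟩

theorem proj_of_mem {p q : ℕ} {a : FreeAlgebra K (Fin n)} (ha : a ∈ freeComponent K n q) :
    proj K n p a = if q = p then a else 0 := by
  rw [freeComponent_eq] at ha
  induction ha using Submodule.span_induction with
  | mem x hx => obtain ⟨w, rfl⟩ := hx; rw [proj_word, List.length_ofFn]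
  | zero => simp
  | add a b _ _ ha hb => rw [map_add, ha, hb]; split_ifs <;> simp
  | smul r a _ ha => rw [map_smul, ha]; split_ifs <;> simp

theorem proj_mem (q : ℕ) (a : FreeAlgebra K (Fin n)) : proj K n q a ∈ freeComponent K n q := by
  induction a using word_induction with
  | hw l =>
    rw [proj_word]
    split_ifs with h
    · exact word_mem_freeComponent h
    · exact zero_mem _
  | h0 => simp
  | hadd a b ha hb => rw [map_add]; exact add_mem ha hb
  | hsmul r a ha => rw [map_smul]; exact Submodule.smul_mem _ _ ha

theorem finrank_freeComponent (q : ℕ) : finrank K (freeComponent K n q) = n ^ q := by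
  have hinj : Function.Injective (List.ofFn : (Fin q → Fin n) → List (Fin n)) :=
    List.ofFn_injective
  have h := (wordBasis K n).linearIndependent.comp _ hinj
  have h' : (fun w : Fin q → Fin n => word K (List.ofFn w)) = wordBasis K n ∘ List.ofFn := by
    funext w; simp
  rw [freeComponent_eq, h', finrank_span_eq_card h]
  simp

instance (q : ℕ) : Module.Finite K (freeComponent K n q) := by
  unfold freeComponent
  exact FiniteDimensional.span_of_finite K (Set.finite_range _)

/-! ### The ideal of relations is homogeneous -/

/-- The quotient map from the free algebra to the quadratic algebra. -/
def toQuot (c : Coeffs K n d) : FreeAlgebra K (Fin n) →ₐ[K] QuadraticAlgebra c :=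
  (relationIdeal c).ringCon.mkₐ (α := K)

theorem toQuot_surjective (c : Coeffs K n d) : Function.Surjective (toQuot c) :=
  RingCon.mkₐ_surjective _

theorem component_eq (c : Coeffs K n d) (q : ℕ) :
    component c q = (freeComponent K n q).map (toQuot c).toLinearMap := rfl

theorem toQuot_eq_zero {c : Coeffs K n d} {a : FreeAlgebra K (Fin n)} :
    toQuot c a = 0 ↔ a ∈ relationIdeal c := by
  rw [TwoSidedIdeal.mem_iff, ← RingCon.eq]
  rfl

theorem toQuot_relation (c : Coeffs K n d) (j : Fin d) : toQuot c (relation c j) = 0 :=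
  toQuot_eq_zero.2 (TwoSidedIdeal.subset_span ⟨j, rfl⟩)

/-- The indices of the products `u f_j v` with `u` and `v` words, that have degree `q`. -/
abbrev RelIndex (n d q : ℕ) : Type :=
  {t : List (Fin n) × Fin d × List (Fin n) // t.1.length + 2 + t.2.2.length = q}

/-- The product `u f_j v`. -/
def relWord (c : Coeffs K n d) (t : List (Fin n) × Fin d × List (Fin n)) :
    FreeAlgebra K (Fin n) :=
  word K t.1 * relation c t.2.1 * word K t.2.2

/-- The span of the products `u f_j v` that have degree `q`. -/
def relComponent (c : Coeffs K n d) (q : ℕ) : Submodule K (FreeAlgebra K (Fin n)) :=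
  Submodule.span K (Set.range fun t : RelIndex n d q => relWord c t.1)

theorem relWord_eq (c : Coeffs K n d) (t : List (Fin n) × Fin d × List (Fin n)) :
    relWord c t = ∑ k, ∑ m, c (t.2.1, k, m) • word K (t.1 ++ [k, m] ++ t.2.2) := by
  simp only [relWord, relation, Finset.mul_sum, Finset.sum_mul, word_append]
  simp [word, mul_assoc]

theorem relWord_mem (c : Coeffs K n d) {q : ℕ} (t : RelIndex n d q) :
    relWord c t.1 ∈ freeComponent K n q := by
  rw [relWord_eq]
  refine sum_mem fun k _ => sum_mem fun m _ => Submodule.smul_mem _ _ (word_mem_freeComponent ?_)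
  have := t.2
  simp only [List.length_append, List.length_cons, List.length_nil]
  omega

theorem relComponent_le (c : Coeffs K n d) (q : ℕ) : relComponent c q ≤ freeComponent K n q := by
  rw [relComponent, Submodule.span_le]
  rintro _ ⟨t, rfl⟩
  exact relWord_mem c t

/-- Every element of the ideal of relations is a linear combination of products `u f_j v`. -/
theorem mem_span_of_mem_relationIdeal {c : Coeffs K n d} {a : FreeAlgebra K (Fin n)}
    (ha : a ∈ relationIdeal c) : a ∈ Submodule.span K (Set.range (relWord c)) := by
  set J := Submodule.span K (Set.range (relWord c)) with hJ
  have hleft : ∀ {x y : FreeAlgebra K (Fin n)}, y ∈ J → x * y ∈ J := by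
    intro x y hy
    induction hy using Submodule.span_induction with
    | mem y hy =>
      obtain ⟨⟨u, j, v⟩, rfl⟩ := hy
      induction x using word_induction with
      | hw l =>
        refine Submodule.subset_span ⟨(l ++ u, j, v), ?_⟩
        simp [relWord, word_append, mul_assoc]
      | h0 => simp
      | hadd a b ha hb => rw [add_mul]; exact add_mem ha hb
      | hsmul r a ha => rw [smul_mul_assoc]; exact Submodule.smul_mem _ _ ha
    | zero => simp
    | add a b _ _ ha hb => rw [mul_add]; exact add_mem ha hb
    | smul r a _ ha => rw [mul_smul_comm]; exact Submodule.smul_mem _ _ ha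
  have hright : ∀ {x y : FreeAlgebra K (Fin n)}, x ∈ J → x * y ∈ J := by
    intro x y hx
    induction hx using Submodule.span_induction with
    | mem x hx =>
      obtain ⟨⟨u, j, v⟩, rfl⟩ := hx
      induction y using word_induction with
      | hw l =>
        refine Submodule.subset_span ⟨(u, j, v ++ l), ?_⟩
        simp [relWord, word_append, mul_assoc]
      | h0 => simp
      | hadd a b ha hb => rw [mul_add]; exact add_mem ha hb
      | hsmul r a ha => rw [mul_smul_comm]; exact Submodule.smul_mem _ _ ha
    | zero => simp
    | add a b _ _ ha hb => rw [add_mul]; exact add_mem ha hb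
    | smul r a _ ha => rw [smul_mul_assoc]; exact Submodule.smul_mem _ _ ha
  have h := TwoSidedIdeal.mem_span_iff.1 ha
    (TwoSidedIdeal.mk' (J : Set (FreeAlgebra K (Fin n))) J.zero_mem J.add_mem J.neg_mem
      hleft hright) (by
        rintro _ ⟨j, rfl⟩
        rw [TwoSidedIdeal.coe_mk']
        exact Submodule.subset_span ⟨([], j, []), by simp [relWord]⟩)
  rwa [TwoSidedIdeal.mem_mk'] at h

theorem toQuot_relWord (c : Coeffs K n d) (t : List (Fin n) × Fin d × List (Fin n)) :
    toQuot c (relWord c t) = 0 := by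
  simp [relWord, toQuot_relation]

/-- Homogeneous parts of elements of the ideal of relations are combinations of products
`u f_j v` of the same degree. -/
theorem proj_mem_relComponent {c : Coeffs K n d} {a : FreeAlgebra K (Fin n)}
    (ha : toQuot c a = 0) (q : ℕ) : proj K n q a ∈ relComponent c q := by
  have h := mem_span_of_mem_relationIdeal (toQuot_eq_zero.1 ha)
  clear ha
  induction h using Submodule.span_induction with
  | mem x hx =>
    obtain ⟨t, rfl⟩ := hx
    rw [proj_of_mem (relWord_mem c ⟨t, rfl⟩)]
    split_ifs with h
    · exact Submodule.subset_span ⟨⟨t, h⟩, rfl⟩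
    · exact zero_mem _
  | zero => simp
  | add x y _ _ hx hy => rw [map_add]; exact add_mem hx hy
  | smul r x _ hx => rw [map_smul]; exact Submodule.smul_mem _ _ hx

theorem toQuot_of_mem_relComponent {c : Coeffs K n d} {q : ℕ} {a : FreeAlgebra K (Fin n)}
    (ha : a ∈ relComponent c q) : toQuot c a = 0 := by
  induction ha using Submodule.span_induction with
  | mem x hx => obtain ⟨t, rfl⟩ := hx; exact toQuot_relWord c t.1
  | zero => simp
  | add x y _ _ hx hy => rw [map_add, hx, hy, add_zero]
  | smul r x _ hx => rw [map_smul, hx, smul_zero]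

theorem toQuot_proj {c : Coeffs K n d} {a : FreeAlgebra K (Fin n)}
    (ha : toQuot c a = 0) (q : ℕ) : toQuot c (proj K n q a) = 0 :=
  toQuot_of_mem_relComponent (proj_mem_relComponent ha q)

instance (c : Coeffs K n d) (q : ℕ) : Module.Finite K (component c q) := by
  rw [component_eq]; infer_instance

instance (c : Coeffs K n d) (q : ℕ) : Module.Finite K (relComponent c q) :=
  Submodule.finiteDimensional_of_le (relComponent_le c q)

theorem finrank_component_add (c : Coeffs K n d) (q : ℕ) :
    finrank K (component c q) + finrank K (relComponent c q) = n ^ q := by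
  have h := LinearMap.finrank_range_add_finrank_ker
    ((toQuot c).toLinearMap.domRestrict (freeComponent K n q))
  rw [finrank_freeComponent, LinearMap.range_domRestrict, ← component_eq] at h
  rw [← h]
  congr 1
  have hker : ((toQuot c).toLinearMap.domRestrict (freeComponent K n q)).ker
      = (relComponent c q).comap (freeComponent K n q).subtype := by
    ext ⟨a, ha⟩
    simp only [LinearMap.mem_ker, LinearMap.domRestrict_apply, Submodule.mem_comap,
      Submodule.subtype_apply, AlgHom.toLinearMap_apply]
    refine ⟨fun h => ?_, toQuot_of_mem_relComponent⟩
    simpa [proj_of_mem ha] using proj_mem_relComponent h q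
  rw [hker]
  exact ((Submodule.comapSubtypeEquivOfLe (relComponent_le c q)).finrank_eq).symm

theorem finrank_component_of_lt_two (c : Coeffs K n d) {q : ℕ} (hq : q < 2) :
    finrank K (component c q) = n ^ q := by
  have : IsEmpty (RelIndex n d q) := ⟨fun t => by have := t.2; omega⟩
  have h := finrank_component_add c q
  rw [relComponent, Set.range_eq_empty, Submodule.span_empty, finrank_bot] at h
  simpa using h

/-! ### The Golod–Shafarevich inequality -/

/-- Exactness at the middle of `R^d → R^n → R`: if `a` lies in the ideal of relations, then
the vector of its right quotients by the letters comes, modulo the ideal, from a vector `e`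
of coefficients of the relations. -/
theorem exists_rightDiv_eq {c : Coeffs K n d} {a : FreeAlgebra K (Fin n)}
    (ha : toQuot c a = 0) : ∃ e : Fin d → FreeAlgebra K (Fin n), ∀ i,
      toQuot c (rightDiv K i a - ∑ j, ∑ k, c (j, k, i) • (e j * FreeAlgebra.ι K k)) = 0 := by
  have h := mem_span_of_mem_relationIdeal (toQuot_eq_zero.1 ha)
  clear ha
  induction h using Submodule.span_induction with
  | mem x hx =>
    obtain ⟨⟨u, j, v⟩, rfl⟩ := hx
    rcases List.eq_nil_or_concat v with rfl | ⟨v, m, rfl⟩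
    · refine ⟨Pi.single j (word K u), fun i => ?_⟩
      have h1 : rightDiv K i (relWord c (u, j, [])) =
          ∑ k, c (j, k, i) • (word K u * FreeAlgebra.ι K k) := by
        simp only [relWord, relation, word_nil, mul_one, Finset.mul_sum, map_sum, mul_smul_comm,
          map_smul, ← mul_assoc, rightDiv_mul_ι, smul_ite, smul_zero]
        simp
      rw [h1, Finset.sum_eq_single j]
      · simp
      · intro b _ hb
        simp [Pi.single_eq_of_ne hb]
      · simp
    · refine ⟨0, fun i => ?_⟩
      have h1 : relWord c (u, j, v.concat m) = relWord c (u, j, v) * FreeAlgebra.ι K m := by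
        simp [relWord, word_concat, mul_assoc]
      rw [h1, rightDiv_mul_ι]
      split_ifs
      · simp [toQuot_relWord]
      · simp
  | zero => exact ⟨0, fun i => by simp⟩
  | add x y _ _ hx hy =>
    obtain ⟨e, he⟩ := hx
    obtain ⟨f, hf⟩ := hy
    refine ⟨e + f, fun i => ?_⟩
    have := congrArg₂ (· + ·) (he i) (hf i)
    simp only [← map_add, add_zero] at this
    rw [← this]
    congr 1
    simp only [map_add, Pi.add_apply, add_mul, smul_add, Finset.sum_add_distrib]
    abel
  | smul r x _ hx =>
    obtain ⟨e, he⟩ := hx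
    refine ⟨r • e, fun i => ?_⟩
    have := congrArg (r • ·) (he i)
    simp only [← map_smul, smul_zero] at this
    rw [← this]
    congr 1
    simp only [map_smul, Pi.smul_apply, smul_mul_assoc, smul_sub, Finset.smul_sum,
      smul_comm r]

theorem mul_mem_component {c : Coeffs K n d} {q : ℕ} {r : QuadraticAlgebra c}
    (hr : r ∈ component c q) (i : Fin n) :
    r * toQuot c (FreeAlgebra.ι K i) ∈ component c (q + 1) := by
  obtain ⟨a, ha, rfl⟩ := hr
  refine ⟨a * FreeAlgebra.ι K i, ?_, map_mul (toQuot c) _ _⟩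
  have h : proj K n (q + 1) (a * FreeAlgebra.ι K i) = a * FreeAlgebra.ι K i := by
    rw [proj_mul_ι, proj_of_mem ha, if_pos rfl]
  rw [← h]
  exact proj_mem _ _

/-- The map `R_q^n → R_{q+1}`, `(r_i) ↦ ∑ r_i x_i`. -/
def mulLetters (c : Coeffs K n d) (q : ℕ) :
    (Fin n → component c q) →ₗ[K] component c (q + 1) :=
  ∑ i, ((LinearMap.mulRight K (toQuot c (FreeAlgebra.ι K i))).restrict
    fun _ h => mul_mem_component h i) ∘ₗ LinearMap.proj i

theorem coe_mulLetters (c : Coeffs K n d) (q : ℕ) (r : Fin n → component c q) :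
    (mulLetters c q r : QuadraticAlgebra c)
      = ∑ i, (r i : QuadraticAlgebra c) * toQuot c (FreeAlgebra.ι K i) := by
  simp [mulLetters, LinearMap.sum_apply]
  rfl

/-- The map `R_q^d → R_{q+1}^n` given by the coefficients of the relations:
`(e_j) ↦ (∑_{j,k} c_{j,k,i} e_j x_k)_i`. -/
def mulRelations (c : Coeffs K n d) (q : ℕ) :
    (Fin d → component c q) →ₗ[K] (Fin n → component c (q + 1)) :=
  LinearMap.pi fun i => ∑ k, ∑ j, c (j, k, i) •
    ((LinearMap.mulRight K (toQuot c (FreeAlgebra.ι K k))).restrict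
      fun _ h => mul_mem_component h k) ∘ₗ LinearMap.proj j

theorem coe_mulRelations (c : Coeffs K n d) (q : ℕ) (e : Fin d → component c q) (i : Fin n) :
    (mulRelations c q e i : QuadraticAlgebra c)
      = ∑ j, ∑ k, c (j, k, i) • ((e j : QuadraticAlgebra c) * toQuot c (FreeAlgebra.ι K k)) := by
  rw [Finset.sum_comm]
  simp [mulRelations, LinearMap.sum_apply]
  rfl

theorem ker_mulLetters_le (c : Coeffs K n d) (q : ℕ) :
    (mulLetters c (q + 1)).ker ≤ (mulRelations c q).range := by
  intro r hr
  have hr' : ∑ i, (r i : QuadraticAlgebra c) * toQuot c (FreeAlgebra.ι K i) = 0 := by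
    rw [← coe_mulLetters, LinearMap.mem_ker.1 hr]; rfl
  have hlift : ∀ i, ∃ a ∈ freeComponent K n (q + 1), toQuot c a = (r i : QuadraticAlgebra c) :=
    fun i => by
      obtain ⟨a, ha, h⟩ := (r i).2
      exact ⟨a, ha, h⟩
  choose a ha har using hlift
  have h0 : toQuot c (∑ i, a i * FreeAlgebra.ι K i) = 0 := by
    rw [map_sum, ← hr']
    simp [har]
  obtain ⟨e, he⟩ := exists_rightDiv_eq h0
  refine ⟨fun j => ⟨toQuot c (proj K n q (e j)), _, proj_mem _ _, rfl⟩, ?_⟩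
  funext i
  apply Subtype.ext
  rw [coe_mulRelations]
  have h1 : rightDiv K i (∑ m, a m * FreeAlgebra.ι K m) = a i := by
    simp [map_sum, rightDiv_mul_ι]
  have h2 := toQuot_proj (he i) (q + 1)
  rw [h1, map_sub, proj_of_mem (ha i), if_pos rfl, map_sub, sub_eq_zero, har] at h2
  rw [h2]
  simp only [map_sum, map_smul, proj_mul_ι, map_mul]

/-- The Golod–Shafarevich inequality `dim R_{q+2} ≥ n dim R_{q+1} - d dim R_q`. -/
theorem golod_shafarevich (c : Coeffs K n d) (q : ℕ) :
    n * finrank K (component c (q + 1)) ≤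
      finrank K (component c (q + 2)) + d * finrank K (component c q) := by
  have h1 := LinearMap.finrank_range_add_finrank_ker (mulLetters c (q + 1))
  have h2 := Submodule.finrank_mono (ker_mulLetters_le c q)
  have h3 := LinearMap.finrank_range_le (mulRelations c q)
  have h4 := Submodule.finrank_le (mulLetters c (q + 1)).range
  rw [finrank_pi_fintype] at h1 h3
  simp only [Finset.sum_const, Finset.card_univ, Fintype.card_fin, smul_eq_mul] at h1 h3
  change _ ≤ finrank K (component c (q + 2)) at h4
  omega

/-! ### Generic ranks -/

/-- The rank of a family of vectors that depend linearly on a parameter is lower semicontinuous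
in the Zariski topology: from a parameter `c₀` one gets a polynomial that does not vanish at `c₀`
and off whose zero set the rank is at least the rank at `c₀`. -/
theorem exists_polynomial_finrank_span_le {σ ι V : Type*} [Fintype σ] [AddCommGroup V]
    [Module K V] (g : ι → (σ → K) →ₗ[K] V)
    [hfin : ∀ c, Module.Finite K (Submodule.span K (Set.range fun i => g i c))] (c₀ : σ → K) :
    ∃ p : MvPolynomial σ K, MvPolynomial.eval c₀ p ≠ 0 ∧ ∀ c, MvPolynomial.eval c p ≠ 0 →
      finrank K (Submodule.span K (Set.range fun i => g i c₀)) ≤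
        finrank K (Submodule.span K (Set.range fun i => g i c)) := by
  classical
  obtain ⟨f, hf, -, hli⟩ := Submodule.exists_fun_fin_finrank_span_eq K
    (Set.range fun i => g i c₀)
  choose t ht using hf
  obtain ⟨L, hL⟩ := LinearMap.exists_leftInverse_of_injective _ (LinearMap.ker_eq_bot.2 hli)
  -- The matrix of the chosen vectors, in coordinates in which it is the identity at `c₀`.
  let M : Matrix _ _ (MvPolynomial σ K) := Matrix.of fun a b =>
    ∑ s, MvPolynomial.C (L (g (t a) (Pi.single s 1)) b) * MvPolynomial.X s
  have hM : ∀ c, MvPolynomial.eval c M.det = (Matrix.of fun a b => L (g (t a) c) b).det := by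
    intro c
    rw [RingHom.map_det]
    congr 1
    ext a b
    have hc : c = ∑ s, c s • (Pi.single s 1 : σ → K) := by
      ext s; simp [Finset.sum_apply, Pi.single_apply]
    conv_rhs => rw [hc]
    simp [M, mul_comm]
  refine ⟨M.det, ?_, fun c hc => ?_⟩
  · rw [hM]
    have : (Matrix.of fun a b => L (g (t a) c₀) b) = 1 := by
      ext a b
      have h1 := LinearMap.congr_fun hL (Finsupp.single a 1)
      simp only [LinearMap.comp_apply, Finsupp.linearCombination_single, one_smul,
        LinearMap.id_apply] at h1
      have h2 : g (t a) c₀ = f a := ht a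
      rw [Matrix.of_apply, h2, h1, Matrix.one_apply, Finsupp.single_apply]
    rw [this, Matrix.det_one]
    exact one_ne_zero
  · rw [hM] at hc
    have hli' : LinearIndependent K fun a => g (t a) c := by
      refine LinearIndependent.of_comp
        ((Finsupp.linearEquivFunOnFinite K K _).toLinearMap ∘ₗ L) ?_
      exact Matrix.linearIndependent_rows_of_det_ne_zero hc
    have hli'' : LinearIndependent K fun a =>
        (⟨g (t a) c, Submodule.subset_span ⟨t a, rfl⟩⟩ :
          Submodule.span K (Set.range fun i => g i c)) :=
      LinearIndependent.of_comp (Submodule.subtype _) hli'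
    simpa using hli''.fintype_card_le_finrank

/-- The product `u f_j v` as a linear function of the coefficients of the relations. -/
def relWordₗ (K : Type*) [Field K] {n d : ℕ} (t : List (Fin n) × Fin d × List (Fin n)) :
    (Fin d × Fin n × Fin n → K) →ₗ[K] FreeAlgebra K (Fin n) where
  toFun c := relWord (c : Coeffs K n d) t
  map_add' c c' := by simp [relWord_eq, add_smul, Finset.sum_add_distrib]
  map_smul' r c := by simp [relWord_eq, Finset.smul_sum, mul_smul]

/-- The dimension of `R_q` is upper semicontinuous: a bound that holds for one algebra holds off
the zero set of a nonzero polynomial. -/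
theorem exists_polynomial_finrank_component_le (c₀ : Coeffs K n d) (q : ℕ) :
    ∃ p : MvPolynomial (Fin d × Fin n × Fin n) K, p ≠ 0 ∧ ∀ c : Coeffs K n d,
      MvPolynomial.eval c p ≠ 0 →
        finrank K (component c q) ≤ finrank K (component c₀ q) := by
  have hfin : ∀ c : Fin d × Fin n × Fin n → K, Module.Finite K
      (Submodule.span K (Set.range fun t : RelIndex n d q => relWordₗ K t.1 c)) :=
    fun c => inferInstanceAs (Module.Finite K (relComponent (c : Coeffs K n d) q))
  obtain ⟨p, hp, h⟩ := exists_polynomial_finrank_span_le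
    (fun t : RelIndex n d q => relWordₗ K t.1) c₀
  refine ⟨p, fun h0 => hp (by simp [h0]), fun c hc => ?_⟩
  have h1 : finrank K (relComponent c₀ q) ≤ finrank K (relComponent c q) := h c hc
  have h2 := finrank_component_add c₀ q
  have h3 := finrank_component_add c q
  omega

/-- A property that holds off the zero set of a nonzero polynomial is generic, if the field is
infinite. -/
theorem generic_of_polynomial [Infinite K] {P : Coeffs K n d → Prop}
    (p : MvPolynomial (Fin d × Fin n × Fin n) K) (hp : p ≠ 0)
    (h : ∀ c : Coeffs K n d, MvPolynomial.eval c p ≠ 0 → P c) : Generic K n d P := by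
  let : TopologicalSpace (Coeffs K n d) := zariskiTopology K (Fin d × Fin n × Fin n)
  refine ⟨{c | MvPolynomial.eval c p ≠ 0}, TopologicalSpace.isOpen_generateFrom_of_mem ⟨p, rfl⟩,
    ?_, h⟩
  rw [(TopologicalSpace.isTopologicalBasis_of_subbasis
    (t := zariskiTopology K (Fin d × Fin n × Fin n)) rfl).dense_iff]
  rintro _ ⟨S, ⟨hSfin, hS⟩, rfl⟩ ⟨x, hx⟩
  -- A nonempty finite intersection of basic open sets contains a nonempty basic open set.
  have key : ∀ S : Set (Set (Coeffs K n d)), S.Finite →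
      S ⊆ Set.range (fun p : MvPolynomial (Fin d × Fin n × Fin n) K =>
        {x | MvPolynomial.eval x p ≠ 0}) → x ∈ ⋂₀ S →
      ∃ r : MvPolynomial (Fin d × Fin n × Fin n) K, r ≠ 0 ∧
        ∀ c, MvPolynomial.eval c r ≠ 0 → c ∈ ⋂₀ S := by
    intro S hSfin
    induction S, hSfin using Set.Finite.induction_on with
    | empty => exact fun _ _ => ⟨1, one_ne_zero, by simp⟩
    | insert _ _ ih =>
      intro hS hx
      rw [Set.sInter_insert] at hx ⊢
      obtain ⟨r, hr, hr'⟩ := ih ((Set.subset_insert _ _).trans hS) hx.2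
      obtain ⟨s, rfl⟩ := hS (Set.mem_insert _ _)
      have hs : s ≠ 0 := fun h0 => hx.1 (by simp [h0])
      refine ⟨s * r, mul_ne_zero hs hr, fun c hc => ?_⟩
      rw [map_mul] at hc
      exact ⟨left_ne_zero_of_mul hc, hr' c (right_ne_zero_of_mul hc)⟩
  obtain ⟨r, hr, hr'⟩ := key S hSfin hS hx
  by_contra hempty
  refine mul_ne_zero hr hp (MvPolynomial.funext fun c => ?_)
  rw [map_zero, map_mul]
  by_contra hne
  exact hempty ⟨c, hr' c (left_ne_zero_of_mul hne), right_ne_zero_of_mul hne⟩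

/-! ### Finite-dimensional quadratic algebras -/

theorem toQuot_word_mem (c : Coeffs K n d) {q : ℕ} {l : List (Fin n)} (hl : l.length = q) :
    toQuot c (word K l) ∈ component c q :=
  ⟨_, word_mem_freeComponent hl, rfl⟩

/-- Once a component vanishes, all later components vanish. -/
theorem component_eq_bot_of_le {c : Coeffs K n d} {N q : ℕ} (hN : component c N = ⊥)
    (hq : N ≤ q) : component c q = ⊥ := by
  induction q, hq using Nat.le_induction with
  | base => exact hN
  | succ q _ ih =>
    rw [eq_bot_iff, component_eq, freeComponent_eq, Submodule.map_span_le]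
    rintro _ ⟨w, rfl⟩
    change toQuot c (word K (List.ofFn w)) ∈ _
    rw [List.ofFn_succ', List.concat_eq_append, word_concat]
    have h : toQuot c (word K (List.ofFn fun i => w i.castSucc)) ∈ component c q :=
      toQuot_word_mem c (by simp)
    rw [ih, Submodule.mem_bot] at h
    simp [h]

/-- The sum of the components of degree less than `N`. -/
def sumComponents (c : Coeffs K n d) (N : ℕ) :
    ((q : Fin N) → component c q) →ₗ[K] QuadraticAlgebra c :=
  ∑ q : Fin N, (component c q).subtype ∘ₗ LinearMap.proj q

theorem sumComponents_apply (c : Coeffs K n d) (N : ℕ) (r : (q : Fin N) → component c q) :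
    sumComponents c N r = ∑ q, (r q : QuadraticAlgebra c) := by
  simp [sumComponents, LinearMap.sum_apply]

theorem sumComponents_injective (c : Coeffs K n d) (N : ℕ) :
    Function.Injective (sumComponents c N) := by
  rw [← LinearMap.ker_eq_bot, eq_bot_iff]
  intro r hr
  rw [LinearMap.mem_ker, sumComponents_apply] at hr
  have hlift : ∀ q : Fin N, ∃ a ∈ freeComponent K n q,
      toQuot c a = (r q : QuadraticAlgebra c) := fun q => by
    obtain ⟨a, ha, h⟩ := (r q).2
    exact ⟨a, ha, h⟩
  choose a ha har using hlift
  have h0 : toQuot c (∑ q, a q) = 0 := by simp [map_sum, har, hr]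
  rw [Submodule.mem_bot]
  funext p
  have h1 := toQuot_proj h0 p
  rw [map_sum, Finset.sum_eq_single p] at h1
  · rw [proj_of_mem (ha p), if_pos rfl, har] at h1
    exact Subtype.ext h1
  · intro q _ hq
    rw [proj_of_mem (ha q), if_neg (fun h => hq (Fin.ext h))]
  · simp

theorem sumComponents_surjective {c : Coeffs K n d} {N : ℕ} (hN : component c N = ⊥) :
    Function.Surjective (sumComponents c N) := by
  rw [← LinearMap.range_eq_top, eq_top_iff]
  intro r _
  obtain ⟨a, rfl⟩ := toQuot_surjective c r
  induction a using word_induction with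
  | hw l =>
    by_cases hl : l.length < N
    · refine ⟨Pi.single ⟨l.length, hl⟩ ⟨_, toQuot_word_mem c rfl⟩, ?_⟩
      rw [sumComponents_apply, Finset.sum_eq_single ⟨l.length, hl⟩]
      · simp
      · intro b _ hb
        simp [Pi.single_eq_of_ne hb]
      · simp
    · have h := toQuot_word_mem c (rfl : l.length = l.length)
      rw [component_eq_bot_of_le hN (not_lt.1 hl), Submodule.mem_bot] at h
      rw [h]
      exact zero_mem _
  | h0 => rw [map_zero]; exact zero_mem _
  | hadd a b ha hb => rw [map_add]; exact add_mem (ha trivial) (hb trivial)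
  | hsmul s a ha => rw [map_smul]; exact Submodule.smul_mem _ _ (ha trivial)

theorem finite_of_component_eq_bot {c : Coeffs K n d} {N : ℕ} (hN : component c N = ⊥) :
    Module.Finite K (QuadraticAlgebra c) :=
  Module.Finite.of_surjective _ (sumComponents_surjective hN)

theorem finrank_eq_sum {c : Coeffs K n d} {N : ℕ} (hN : component c N = ⊥) :
    finrank K (QuadraticAlgebra c) = ∑ q ∈ Finset.range N, finrank K (component c q) := by
  rw [← (LinearEquiv.ofBijective _
    ⟨sumComponents_injective c N, sumComponents_surjective hN⟩).finrank_eq,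
    finrank_pi_fintype, Finset.sum_range]

theorem finrank_component_eq_zero_of_le {c : Coeffs K n d} {N q : ℕ} (hN : component c N = ⊥)
    (hq : N ≤ q) : finrank K (component c q) = 0 := by
  rw [component_eq_bot_of_le hN hq, finrank_bot]

/-! ### Dimensions forced by the Golod–Shafarevich inequality -/

theorem two_mul_choose_two (n : ℕ) : 2 * (n * (n - 1) / 2) + n = n * n := by
  rw [Nat.mul_div_cancel' (Nat.even_mul_pred_self n).two_dvd]
  cases n with
  | zero => rfl
  | succ n => simp; ring

/-- With `n(n-1)/2` relations, minimality of `R_3` determines all dimensions up to degree 3. -/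
theorem finrank_component_two_three (hn : 0 < n) {c : Coeffs K n (n * (n - 1) / 2)}
    (h3 : finrank K (component c 3) ≤ n ^ 2) :
    finrank K (component c 2) = n * (n + 1) / 2 ∧ finrank K (component c 3) = n ^ 2 := by
  have hd := two_mul_choose_two n
  have h0 := finrank_component_of_lt_two c (q := 0) (by norm_num)
  have h1 := finrank_component_of_lt_two c (q := 1) (by norm_num)
  have g0 := golod_shafarevich c 0
  have g1 := golod_shafarevich c 1
  simp only [Nat.reduceAdd] at g0 g1
  rw [h0, h1] at g0
  rw [h1] at g1
  generalize finrank K (component c 2) = r₂ at *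
  generalize finrank K (component c 3) = r₃ at *
  generalize n * (n - 1) / 2 = d at *
  have hle : r₂ ≤ n + d := by
    refine Nat.le_of_mul_le_mul_left ?_ hn
    nlinarith
  have h2 : r₂ = n + d := by
    refine le_antisymm hle ?_
    have : n * n ≤ r₂ + d := by simpa using g0
    omega
  refine ⟨?_, le_antisymm h3 ?_⟩
  · have : n * (n + 1) = 2 * (n + d) := by rw [mul_add]; omega
    rw [this, h2]; simp
  · subst h2
    nlinarith

theorem hilbertSeries_eq_of_bot {c : Coeffs K n d} {N : ℕ} (hN : component c N = ⊥) :
    hilbertSeries c = ∑ q ∈ Finset.range N,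
      (finrank K (component c q) : PowerSeries ℤ) * PowerSeries.X ^ q := by
  ext q
  rw [hilbertSeries, PowerSeries.coeff_mk, map_sum]
  have hcoeff : ∀ p, PowerSeries.coeff q
      ((finrank K (component c p) : PowerSeries ℤ) * PowerSeries.X ^ p)
      = if q = p then (finrank K (component c p) : ℤ) else 0 := fun p => by
    rw [← map_natCast (PowerSeries.C (R := ℤ)), PowerSeries.coeff_C_mul_X_pow]
  simp only [hcoeff]
  rw [Finset.sum_ite_eq]
  split_ifs with h
  · rfl
  · rw [finrank_component_eq_zero_of_le hN (by simpa using h), Nat.cast_zero]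

theorem component_eq_bot_of_finrank {c : Coeffs K n d} {q : ℕ}
    (h : finrank K (component c q) ≤ 0) : component c q = ⊥ :=
  Submodule.finrank_eq_zero.1 (Nat.le_zero.1 h)

/-! ### Words over a quadratic semigroup presentation -/

/-- A quadratic semigroup relation `ab = ce`, or `ab = 0`, between letters that are coded by
natural numbers. -/
abbrev SemigroupRel : Type := (ℕ × ℕ) × Option (ℕ × ℕ)

/-- The pairs `ce` for which `ab = ce` or `ce = ab` is among the relations. -/
def pairNeighbors (rels : List SemigroupRel) (a b : ℕ) : List (ℕ × ℕ) :=
  rels.filterMap fun r =>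
    match r with
    | (_, none) => none
    | ((a', b'), some (c, e)) =>
      if (a' == a && b' == b) = true then some (c, e)
      else if (c == a && e == b) = true then some (a', b') else none

/-- The words obtained from a word by applying one relation `ab = ce` in one place. -/
def neighbors (rels : List SemigroupRel) : List ℕ → List (List ℕ)
  | [] => []
  | a :: l =>
    match l with
    | [] => []
    | b :: l' => (pairNeighbors rels a b).map (fun t => t.1 :: t.2 :: l') ++
        (neighbors rels l).map (a :: ·)

/-- Whether a word has a subword `ab` such that `ab = 0` is a relation. -/
def hasZeroPair (rels : List SemigroupRel) : List ℕ → Bool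
  | [] => false
  | a :: l =>
    match l with
    | [] => false
    | b :: _ => rels.any (fun r => r.2.isNone && (r.1.1 == a && r.1.2 == b)) ||
        hasZeroPair rels l

/-- All words of length `q` in the letters `0, …, p - 1`. -/
def allWords (p : ℕ) : ℕ → List (List ℕ)
  | 0 => [[]]
  | q + 1 => (List.range p).flatMap fun a => (allWords p q).map (a :: ·)

/-- The number with base `p` digits `w`. -/
def wordCode (p : ℕ) : List ℕ → ℕ
  | [] => 0
  | a :: l => a + p * wordCode p l

/-- Adds words to a set of words, which is represented by the bits of a natural number. -/
def insertWords (p : ℕ) (V : ℕ) : List (List ℕ) → ℕ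
  | [] => V
  | w :: L => insertWords p (V ||| (1 <<< wordCode p w)) L

/-- Graph search: closes the set `V` of words under `neighbors`, where `Q` is the list of those
elements of `V` whose neighbors have not been added yet; the first argument bounds the number of
steps. -/
def searchWords (rels : List SemigroupRel) (p : ℕ) : ℕ → List (List ℕ) → ℕ → ℕ
  | 0, _, V => V
  | _ + 1, [], V => V
  | f + 1, w :: Q, V =>
    let ns := (neighbors rels w).filter fun u => !V.testBit (wordCode p u)
    searchWords rels p f (ns ++ Q) (insertWords p V ns)

/-- Whether the relations connect every word of length `q` in `p` letters to a word with a
vanishing subword or to one of the words `S`. -/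
def reduces (rels : List SemigroupRel) (p q : ℕ) (S : List (List ℕ)) : Bool :=
  let Q := (allWords p q).filter (hasZeroPair rels) ++ S
  searchWords rels p (2 * p ^ q) Q (insertWords p 0 Q) == 2 ^ p ^ q - 1

theorem testBit_or_one_shiftLeft {V m k : ℕ} :
    (V ||| (1 <<< m)).testBit k = true ↔ V.testBit k = true ∨ k = m := by
  rw [Nat.testBit_or, Nat.one_shiftLeft, Nat.testBit_two_pow, Bool.or_eq_true, decide_eq_true_eq]
  exact or_congr Iff.rfl eq_comm

theorem wordCode_injective {p : ℕ} {w w' : List ℕ} (hlen : w.length = w'.length)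
    (hw : ∀ a ∈ w, a < p) (hw' : ∀ a ∈ w', a < p) (h : wordCode p w = wordCode p w') :
    w = w' := by
  induction w generalizing w' with
  | nil => exact (List.length_eq_zero_iff.1 hlen.symm).symm
  | cons a l ih =>
    cases w' with
    | nil => simp at hlen
    | cons b l' =>
      simp only [List.mem_cons, forall_eq_or_imp] at hw hw'
      simp only [wordCode] at h
      have h1 := congrArg (· % p) h
      simp only [Nat.add_mul_mod_self_left, Nat.mod_eq_of_lt hw.1, Nat.mod_eq_of_lt hw'.1] at h1
      subst h1
      have h2 := Nat.eq_of_mul_eq_mul_left (by omega) (Nat.add_left_cancel h)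
      rw [ih (by simpa using hlen) hw.2 hw'.2 h2]

theorem wordCode_lt {p : ℕ} {w : List ℕ} (hw : ∀ a ∈ w, a < p) :
    wordCode p w < p ^ w.length := by
  induction w with
  | nil => simp [wordCode]
  | cons a l ih =>
    simp only [List.mem_cons, forall_eq_or_imp] at hw
    have h := ih hw.2
    have h1 : p * (wordCode p l + 1) ≤ p * p ^ l.length := Nat.mul_le_mul_left _ h
    rw [wordCode, List.length_cons, pow_succ']
    have := hw.1
    rw [mul_add] at h1
    omega

/-- All letters of the relations are less than `p`. -/
def LettersLT (rels : List SemigroupRel) (p : ℕ) : Prop :=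
  ∀ r ∈ rels, (r.1.1 < p ∧ r.1.2 < p) ∧ ∀ t ∈ r.2, t.1 < p ∧ t.2 < p

theorem mem_pairNeighbors {rels : List SemigroupRel} {a b : ℕ} {t : ℕ × ℕ}
    (h : t ∈ pairNeighbors rels a b) : ((a, b), some t) ∈ rels ∨ (t, some (a, b)) ∈ rels := by
  obtain ⟨⟨⟨a', b'⟩, o⟩, hr, ho⟩ := List.mem_filterMap.1 h
  rcases o with _ | ⟨c, e⟩
  · simp at ho
  · simp only [Bool.and_eq_true, beq_iff_eq] at ho
    split_ifs at ho with h1 h2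
    · obtain ⟨rfl, rfl⟩ := h1
      cases ho
      exact Or.inl hr
    · obtain ⟨rfl, rfl⟩ := h2
      cases ho
      exact Or.inr hr

theorem neighbors_letters {rels : List SemigroupRel} {p : ℕ} (hp : LettersLT rels p)
    {w u : List ℕ} (hu : u ∈ neighbors rels w) :
    u.length = w.length ∧ ((∀ a ∈ w, a < p) → ∀ a ∈ u, a < p) := by
  induction w generalizing u with
  | nil => simp [neighbors] at hu
  | cons a l ih =>
    cases l with
    | nil => simp [neighbors] at hu
    | cons b l =>
      simp only [neighbors, List.mem_append, List.mem_map] at hu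
      rcases hu with ⟨⟨c, e⟩, ht, rfl⟩ | ⟨v, hv, rfl⟩
      · have hce : c < p ∧ e < p := by
          rcases mem_pairNeighbors ht with h | h
          · exact (hp _ h).2 _ rfl
          · exact (hp _ h).1
        simp only [List.length_cons, List.mem_cons, forall_eq_or_imp]
        exact ⟨trivial, fun h => ⟨hce.1, hce.2, h.2.2⟩⟩
      · obtain ⟨h1, h2⟩ := ih hv
        refine ⟨by simp [h1], fun h => ?_⟩
        rw [List.forall_mem_cons] at h ⊢
        exact ⟨h.1, h2 h.2⟩

theorem insertWords_induction {p q : ℕ} {P : List ℕ → Prop} {L : List (List ℕ)} {V : ℕ}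
    (hL : ∀ w ∈ L, (w.length = q ∧ ∀ a ∈ w, a < p) ∧ P w)
    (hV : ∀ w : List ℕ, w.length = q → (∀ a ∈ w, a < p) →
      V.testBit (wordCode p w) = true → P w) :
    ∀ w : List ℕ, w.length = q → (∀ a ∈ w, a < p) →
      (insertWords p V L).testBit (wordCode p w) = true → P w := by
  induction L generalizing V with
  | nil => exact hV
  | cons u L ih =>
    rw [List.forall_mem_cons] at hL
    refine ih hL.2 fun w hlen hw h => ?_
    rcases testBit_or_one_shiftLeft.1 h with h | h
    · exact hV w hlen hw h
    · rw [wordCode_injective (hlen.trans hL.1.1.1.symm) hw hL.1.1.2 h]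
      exact hL.1.2

theorem searchWords_induction {rels : List SemigroupRel} {p q : ℕ} (hp : LettersLT rels p)
    {P : List ℕ → Prop} (hP : ∀ w : List ℕ, w.length = q → P w → ∀ u ∈ neighbors rels w, P u)
    {f : ℕ} {Q : List (List ℕ)} {V : ℕ}
    (hQ : ∀ w ∈ Q, (w.length = q ∧ ∀ a ∈ w, a < p) ∧ P w)
    (hV : ∀ w : List ℕ, w.length = q → (∀ a ∈ w, a < p) →
      V.testBit (wordCode p w) = true → P w) :
    ∀ w : List ℕ, w.length = q → (∀ a ∈ w, a < p) →
      (searchWords rels p f Q V).testBit (wordCode p w) = true → P w := by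
  induction f generalizing Q V with
  | zero => simpa [searchWords] using hV
  | succ f ih =>
    cases Q with
    | nil => simpa [searchWords] using hV
    | cons w Q =>
      rw [List.forall_mem_cons] at hQ
      have hns : ∀ u ∈ (neighbors rels w).filter (fun u => !V.testBit (wordCode p u)),
          (u.length = q ∧ ∀ a ∈ u, a < p) ∧ P u := by
        intro u hu
        have hu' := (List.mem_filter.1 hu).1
        obtain ⟨h1, h2⟩ := neighbors_letters hp hu'
        exact ⟨⟨h1.trans hQ.1.1.1, h2 hQ.1.1.2⟩, hP w hQ.1.1.1 hQ.1.2 u hu'⟩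
      refine ih (fun u hu => ?_) (insertWords_induction hns hV)
      rcases List.mem_append.1 hu with hu | hu
      · exact hns u hu
      · exact hQ.2 u hu

theorem mem_allWords {p q : ℕ} {w : List ℕ} :
    w ∈ allWords p q ↔ w.length = q ∧ ∀ a ∈ w, a < p := by
  induction q generalizing w with
  | zero =>
    simp only [allWords, List.mem_singleton, List.length_eq_zero_iff]
    exact ⟨fun h => ⟨h, by simp [h]⟩, fun h => h.1⟩
  | succ q ih =>
    simp only [allWords, List.mem_flatMap, List.mem_range, List.mem_map, ih]
    constructor
    · rintro ⟨a, ha, l, ⟨hl, hl'⟩, rfl⟩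
      simp only [List.length_cons, hl, List.mem_cons, forall_eq_or_imp]
      exact ⟨trivial, ha, hl'⟩
    · rintro ⟨h1, h2⟩
      cases w with
      | nil => simp at h1
      | cons a l =>
        rw [List.forall_mem_cons] at h2
        exact ⟨a, h2.1, l, ⟨by simpa using h1, h2.2⟩, rfl⟩

/-- Soundness of the search: a property that holds for words with a vanishing subword and for the
words `S`, and is preserved by the relations, holds for all words. -/
theorem reduces_induction {rels : List SemigroupRel} {p q : ℕ} {S : List (List ℕ)}
    (hred : reduces rels p q S = true) (hp : LettersLT rels p) {P : List ℕ → Prop}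
    (hP : ∀ w : List ℕ, w.length = q → P w → ∀ u ∈ neighbors rels w, P u)
    (hzero : ∀ w : List ℕ, w.length = q → hasZeroPair rels w = true → P w)
    (hS : ∀ w ∈ S, (w.length = q ∧ ∀ a ∈ w, a < p) ∧ P w)
    {w : List ℕ} (hlen : w.length = q) (hw : ∀ a ∈ w, a < p) : P w := by
  rw [reduces, beq_iff_eq] at hred
  have hQ : ∀ w ∈ (allWords p q).filter (hasZeroPair rels) ++ S,
      (w.length = q ∧ ∀ a ∈ w, a < p) ∧ P w := by
    intro w h
    rcases List.mem_append.1 h with h | h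
    · obtain ⟨h1, h2⟩ := List.mem_filter.1 h
      rw [mem_allWords] at h1
      exact ⟨h1, hzero w h1.1 h2⟩
    · exact hS w h
  refine searchWords_induction (f := 2 * p ^ q) hp hP hQ
    (insertWords_induction (V := 0) hQ fun w _ _ h => by simp at h) w hlen hw ?_
  rw [hred, Nat.testBit_two_pow_sub_one, decide_eq_true_eq, ← hlen]
  exact wordCode_lt hw

/-! ### Products of letters that satisfy the relations indexwise -/

/-- The right-hand side `x_c(i) x_e(j)` of a relation, or `0`. -/
def relRHS {R : Type*} [Semiring R] (x : ℕ → ℕ → R) (i j : ℕ) : Option (ℕ × ℕ) → R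
  | none => 0
  | some t => x t.1 i * x t.2 j

/-- The product `x_{w_1}(i_1) x_{w_2}(i_2) ⋯`. -/
def indexedProd {R : Type*} [Semiring R] (x : ℕ → ℕ → R) (w idx : List ℕ) : R :=
  (List.zipWith x w idx).prod

section

variable {R : Type*} [Semiring R] {x : ℕ → ℕ → R} {rels : List SemigroupRel}

theorem indexedProd_neighbor
    (hx : ∀ r ∈ rels, ∀ i j, x r.1.1 i * x r.1.2 j = relRHS x i j r.2)
    {w u idx : List ℕ} (hidx : idx.length = w.length) (hu : u ∈ neighbors rels w) :
    indexedProd x u idx = indexedProd x w idx := by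
  induction w generalizing u idx with
  | nil => simp [neighbors] at hu
  | cons a l ih =>
    cases l with
    | nil => simp [neighbors] at hu
    | cons b l =>
      match idx, hidx with
      | i :: j :: idx, hidx =>
        simp only [neighbors, List.mem_append, List.mem_map] at hu
        rcases hu with ⟨⟨c, e⟩, ht, rfl⟩ | ⟨v, hv, rfl⟩
        · have h : x c i * x e j = x a i * x b j := by
            rcases mem_pairNeighbors ht with h | h
            · exact (hx _ h i j).symm
            · exact hx _ h i j
          simp only [indexedProd, List.zipWith_cons_cons, List.prod_cons, ← mul_assoc, h]
        · have h := ih (idx := j :: idx) (by simpa using hidx) hv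
          simp only [indexedProd, List.zipWith_cons_cons, List.prod_cons] at h ⊢
          rw [h]

theorem indexedProd_eq_zero
    (hx : ∀ r ∈ rels, ∀ i j, x r.1.1 i * x r.1.2 j = relRHS x i j r.2)
    {w idx : List ℕ} (hidx : idx.length = w.length) (hw : hasZeroPair rels w = true) :
    indexedProd x w idx = 0 := by
  induction w generalizing idx with
  | nil => simp [hasZeroPair] at hw
  | cons a l ih =>
    cases l with
    | nil => simp [hasZeroPair] at hw
    | cons b l =>
      match idx, hidx with
      | i :: j :: idx, hidx =>
        simp only [hasZeroPair, Bool.or_eq_true, List.any_eq_true, Bool.and_eq_true,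
          beq_iff_eq, Option.isNone_iff_eq_none] at hw
        simp only [indexedProd, List.zipWith_cons_cons, List.prod_cons]
        rcases hw with ⟨⟨⟨a', b'⟩, o⟩, hr, h1, h2, h3⟩ | hw
        · simp only at h1 h2 h3
          subst h1 h2 h3
          have h : x a' i * x b' j = 0 := hx _ hr i j
          rw [← mul_assoc, h, zero_mul]
        · have h := ih (idx := j :: idx) (by simpa using hidx) hw
          simp only [indexedProd, List.zipWith_cons_cons, List.prod_cons] at h
          rw [h, mul_zero]

/-- If the search succeeds, then all products of `q` letters lie in each set that contains `0`
and the products spelled by the words `S`. -/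
theorem indexedProd_mem {p q : ℕ} {S : List (List ℕ)}
    (hred : reduces rels p q S = true) (hp : LettersLT rels p)
    (hx : ∀ r ∈ rels, ∀ i j, x r.1.1 i * x r.1.2 j = relRHS x i j r.2)
    {N : Set R} (h0 : 0 ∈ N)
    (hS : ∀ w ∈ S, (w.length = q ∧ ∀ a ∈ w, a < p) ∧
      ∀ idx : List ℕ, idx.length = q → indexedProd x w idx ∈ N)
    {w idx : List ℕ} (hlen : w.length = q) (hw : ∀ a ∈ w, a < p) (hidx : idx.length = q) :
    indexedProd x w idx ∈ N := by
  refine reduces_induction hred hp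
    (P := fun w => ∀ idx : List ℕ, idx.length = q → indexedProd x w idx ∈ N)
    (fun w hw h u hu idx hidx => ?_) (fun w hw h idx hidx => ?_) hS hlen hw idx hidx
  · rw [indexedProd_neighbor hx (hidx.trans hw.symm) hu]
    exact h idx hidx
  · rw [indexedProd_eq_zero hx (hidx.trans hw.symm) h]
    exact h0

end

/-! ### Quadratic algebras with prescribed relations -/

theorem ι_mul_ι_mem (k m : Fin n) :
    FreeAlgebra.ι K k * FreeAlgebra.ι K m ∈ freeComponent K n 2 := by
  have h : word K [k, m] ∈ freeComponent K n 2 := word_mem_freeComponent rfl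
  simpa [word] using h

theorem exists_coeff_of_mem {f : FreeAlgebra K (Fin n)} (hf : f ∈ freeComponent K n 2) :
    ∃ a : Fin n → Fin n → K,
      f = ∑ k, ∑ m, a k m • (FreeAlgebra.ι K k * FreeAlgebra.ι K m) := by
  rw [freeComponent, Submodule.mem_span_range_iff_exists_fun] at hf
  obtain ⟨a, rfl⟩ := hf
  refine ⟨fun k m => a ![k, m], ?_⟩
  rw [← Fintype.sum_prod_type', ← (finTwoArrowEquiv (Fin n)).symm.sum_comp]
  simp [List.ofFn_succ]

/-- Every family of at most `d` homogeneous quadratic elements vanishes in some quadratic algebra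
with `d` relations. -/
theorem exists_coeffs {ρ : Type*} [Fintype ρ] (hρ : Fintype.card ρ ≤ d)
    (f : ρ → FreeAlgebra K (Fin n)) (hf : ∀ t, f t ∈ freeComponent K n 2) :
    ∃ c : Coeffs K n d, ∀ t, toQuot c (f t) = 0 := by
  choose a ha using fun t => exists_coeff_of_mem (hf t)
  obtain ⟨e⟩ : Nonempty (ρ ↪ Fin d) :=
    Function.Embedding.nonempty_of_card_le (by simpa using hρ)
  refine ⟨fun i => Function.extend e a 0 i.1 i.2.1 i.2.2, fun t => ?_⟩
  convert toQuot_relation (fun i => Function.extend e a 0 i.1 i.2.1 i.2.2) (e t) using 2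
  rw [relation, ha]
  simp [e.injective.extend_apply]

theorem finrank_component_le {c : Coeffs K n d} {q : ℕ} {τ : Type*} [Fintype τ]
    (T : τ → QuadraticAlgebra c) (h : ∀ l : List (Fin n), l.length = q →
      toQuot c (word K l) ∈ Submodule.span K (Set.range T)) :
    finrank K (component c q) ≤ Fintype.card τ := by
  have hle : component c q ≤ Submodule.span K (Set.range T) := by
    rw [component_eq, freeComponent_eq, Submodule.map_span_le]
    rintro _ ⟨w, rfl⟩
    exact h _ (by simp)
  have : Module.Finite K (Submodule.span K (Set.range T)) :=
    FiniteDimensional.span_of_finite K (Set.finite_range T)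
  exact (Submodule.finrank_mono hle).trans (finrank_range_le_card T)

/-! ### Blow-ups of semigroup presentations -/

/-- The letter `x_w(i)` of the blow-up of a presentation, in which the letter `w` is replaced by
`s w` letters; it is `0` if the indices are out of range. -/
def blowupLetter (K : Type*) [Field K] {p : ℕ} (s : ℕ → ℕ) (w i : ℕ) :
    FreeAlgebra K (Fin (∑ a : Fin p, s a)) :=
  if h : w < p then
    if h' : i < s w then FreeAlgebra.ι K (finSigmaFinEquiv ⟨⟨w, h⟩, ⟨i, h'⟩⟩) else 0
  else 0

/-- The index pairs for which the left-hand side or the right-hand side of a relation is not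
trivially zero. -/
def relSupport (s : ℕ → ℕ) (r : SemigroupRel) : Finset (ℕ × ℕ) :=
  Finset.range (s r.1.1) ×ˢ Finset.range (s r.1.2) ∪
    match r.2 with
    | none => ∅
    | some t => Finset.range (s t.1) ×ˢ Finset.range (s t.2)

/-- The number of relations `x_a(i) x_b(j) = x_c(i) x_e(j)` of the blow-up that come from one
relation `ab = ce`. -/
def relCost (s : ℕ → ℕ) (r : SemigroupRel) : ℕ :=
  match r with
  | ((a, b), none) => s a * s b
  | ((a, b), some (c, e)) => s a * s b + s c * s e - min (s a) (s c) * min (s b) (s e)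

theorem card_relSupport (s : ℕ → ℕ) (r : SemigroupRel) : (relSupport s r).card = relCost s r := by
  obtain ⟨⟨a, b⟩, _ | ⟨c, e⟩⟩ := r
  · simp [relSupport, relCost]
  · have hr : ∀ k l : ℕ, Finset.range k ∩ Finset.range l = Finset.range (min k l) := by
      intro k l; ext; simp
    simp only [relSupport, relCost, Finset.card_union, Finset.product_inter_product, hr,
      Finset.card_product, Finset.card_range]

section

variable {p : ℕ} {s : ℕ → ℕ}

theorem blowupLetter_eq_zero {w i : ℕ} (h : s w ≤ i) : blowupLetter K (p := p) s w i = 0 := by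
  unfold blowupLetter
  split_ifs
  · omega
  · rfl
  · rfl

theorem blowupLetter_mul_mem (w i w' i' : ℕ) :
    blowupLetter K (p := p) s w i * blowupLetter K s w' i' ∈ freeComponent K _ 2 := by
  unfold blowupLetter
  split_ifs <;> first | exact ι_mul_ι_mem _ _ | simp

theorem map_relRHS {R R' : Type*} [Semiring R] [Semiring R'] (φ : R →+* R') (x : ℕ → ℕ → R)
    (i j : ℕ) (o : Option (ℕ × ℕ)) :
    φ (relRHS x i j o) = relRHS (fun w k => φ (x w k)) i j o := by
  cases o <;> simp [relRHS]

theorem word_eq_indexedProd {R : Type*} [Ring R] [Algebra K R]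
    (φ : FreeAlgebra K (Fin (∑ a : Fin p, s a)) →ₐ[K] R) (l : List (Fin (∑ a : Fin p, s a))) :
    φ (word K l) = indexedProd (fun w i => φ (blowupLetter K s w i))
      (l.map fun m => ((finSigmaFinEquiv.symm m).1 : ℕ))
      (l.map fun m => ((finSigmaFinEquiv.symm m).2 : ℕ)) := by
  rw [indexedProd, List.zipWith_map, List.zipWith_self, word, map_list_prod, List.map_map]
  congr 1
  refine List.map_congr_left fun m _ => ?_
  simp [blowupLetter]

/-- A semigroup presentation for which the search succeeds bounds the dimension of a component
of some quadratic algebra with `∑ s_a` letters, obtained by blowing up the letter `a` into `s_a`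
letters. Words of `S` may only use letters that are not multiplied, as each of them has to stand
for a single product. -/
theorem exists_finrank_component_le {rels : List SemigroupRel} {q : ℕ} {S : List (List ℕ)}
    (hred : reduces rels p q S = true) (hp : LettersLT rels p)
    (hS : ∀ w ∈ S, (w.length = q ∧ ∀ a ∈ w, a < p) ∧ ∀ a ∈ w, s a ≤ 1)
    (hn : ∑ a : Fin p, s a = n) (hd : (rels.map (relCost s)).sum ≤ d) :
    ∃ c : Coeffs K n d, finrank K (component c q) ≤ S.length := by
  subst hn
  set x := blowupLetter K (p := p) s with hxdef
  let ρ := Σ k : Fin rels.length, relSupport s rels[k]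
  let f : ρ → FreeAlgebra K (Fin (∑ a : Fin p, s a)) := fun t =>
    x rels[t.1].1.1 t.2.1.1 * x rels[t.1].1.2 t.2.1.2 - relRHS x t.2.1.1 t.2.1.2 rels[t.1].2
  have hρ : Fintype.card ρ ≤ d := by
    refine le_of_eq_of_le ?_ hd
    simp only [ρ, Fintype.card_sigma, Fintype.card_coe, card_relSupport]
    rw [← List.sum_ofFn]
    congr 1
    apply List.ext_getElem <;> simp
  have hf : ∀ t, f t ∈ freeComponent K _ 2 := by
    intro t
    refine sub_mem (blowupLetter_mul_mem _ _ _ _) ?_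
    cases rels[t.1].2 with
    | none => exact zero_mem _
    | some u => exact blowupLetter_mul_mem _ _ _ _
  obtain ⟨c, hc⟩ := exists_coeffs hρ f hf
  refine ⟨c, ?_⟩
  have hx : ∀ r ∈ rels, ∀ i j, toQuot c (x r.1.1 i) * toQuot c (x r.1.2 j)
      = relRHS (fun w k => toQuot c (x w k)) i j r.2 := by
    intro r hr i j
    have hrhs := map_relRHS (toQuot c).toRingHom x i j r.2
    refine Eq.trans ?_ hrhs
    rw [← map_mul]
    by_cases hij : (i, j) ∈ relSupport s r
    · obtain ⟨k, hk, rfl⟩ := List.getElem_of_mem hr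
      have := hc ⟨⟨k, hk⟩, ⟨(i, j), hij⟩⟩
      rwa [map_sub, sub_eq_zero] at this
    · -- Out of the support both sides vanish.
      have hmul : ∀ a b, ¬(i < s a ∧ j < s b) → x a i * x b j = 0 := by
        intro a b h
        rcases not_and_or.1 h with h | h
        · rw [hxdef, blowupLetter_eq_zero (not_lt.1 h), zero_mul]
        · rw [hxdef, blowupLetter_eq_zero (w := b) (not_lt.1 h), mul_zero]
      obtain ⟨⟨a, b⟩, _ | ⟨a', b'⟩⟩ := r
      · simp only [relSupport, Finset.union_empty, Finset.mem_product, Finset.mem_range] at hij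
        rw [hmul _ _ hij]
        rfl
      · simp only [relSupport, Finset.mem_union, Finset.mem_product, Finset.mem_range,
          not_or] at hij
        rw [hmul _ _ hij.1, relRHS, hmul _ _ hij.2]
        rfl
  let T : Fin S.length → QuadraticAlgebra c := fun k =>
    indexedProd (fun w i => toQuot c (x w i)) S[k] (List.replicate q 0)
  refine (finrank_component_le T fun l hl => ?_).trans (by simp)
  rw [word_eq_indexedProd]
  refine indexedProd_mem (N := (Submodule.span K (Set.range T) : Set (QuadraticAlgebra c)))
    hred hp hx (zero_mem _) (fun w hw => ⟨(hS w hw).1, fun idx hidx => ?_⟩)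
    (by simpa using hl) ?_ (by simpa using hl)
  · by_cases h : ∀ i ∈ idx, i = 0
    · obtain ⟨k, hk, rfl⟩ := List.getElem_of_mem hw
      rw [List.eq_replicate_of_mem h, hidx]
      exact Submodule.subset_span ⟨⟨k, hk⟩, rfl⟩
    · -- Letters that are not blown up vanish for positive indices.
      push Not at h
      obtain ⟨i, hi, hi0⟩ := h
      obtain ⟨k, hk, rfl⟩ := List.getElem_of_mem hi
      have hk' : k < w.length := by rw [(hS w hw).1.1, ← hidx]; exact hk
      have h0 : (0 : QuadraticAlgebra c) ∈
          List.zipWith (fun w i => toQuot c (x w i)) w idx := by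
        have h1 := (hS w hw).2 _ (List.getElem_mem hk')
        refine List.mem_iff_getElem.2 ⟨k, by simp [hk, hk'], ?_⟩
        rw [List.getElem_zipWith, hxdef, blowupLetter_eq_zero (by omega), map_zero]
      rw [indexedProd, List.prod_eq_zero h0]
      exact zero_mem _
  · intro a ha
    obtain ⟨m, -, rfl⟩ := List.mem_map.1 ha
    exact Fin.is_lt _

end

/-! ### Quadratic algebras with a minimal component of degree three -/

/-- In the presence of the relations `x_i y_j = 0` and `x_i x_j = y_i y_j` (`j < b - 1`), all
products of three letters are spanned by the products `y_i y_j v` and `v x_j x_k` in which the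
relations do not apply to `y_i y_j` and `x_j x_k`. -/
theorem mul_mul_mem_of_relations {R : Type*} [Ring R] [Algebra K R] {a b : ℕ} (hab : a ≤ b)
    {X : Fin a → R} {Y : Fin b → R} (hXY : ∀ i j, X i * Y j = 0)
    (hXX : ∀ i j : Fin a, (j : ℕ) < b - 1 → X i * X j = Y (Fin.castLE hab i) * Y (Fin.castLE hab j))
    {N : Submodule K R}
    (hY : ∀ i j : Fin b, ¬((i : ℕ) < a ∧ (j : ℕ) < b - 1) → ∀ v, Y i * Y j * Sum.elim X Y v ∈ N)
    (hX : ∀ v, ∀ j k : Fin a, ¬((k : ℕ) < b - 1) → Sum.elim X Y v * X j * X k ∈ N)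
    (hba : b - 1 ≤ a) (u v w : Fin a ⊕ Fin b) :
    Sum.elim X Y u * Sum.elim X Y v * Sum.elim X Y w ∈ N := by
  have hYY : ∀ i j : Fin b, ∀ hi : (i : ℕ) < a, ∀ hj : (j : ℕ) < b - 1,
      Y i * Y j = X ⟨i, hi⟩ * X ⟨j, hj.trans_le hba⟩ := fun i j hi hj =>
    (hXX ⟨i, hi⟩ ⟨j, hj.trans_le hba⟩ hj).symm
  have hxxx : ∀ i j k, X i * X j * X k ∈ N := by
    intro i j k
    by_cases hk : (k : ℕ) < b - 1
    · rw [mul_assoc, hXX j k hk, ← mul_assoc, hXY, zero_mul]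
      exact zero_mem _
    · exact hX (Sum.inl i) j k hk
  have hyyx : ∀ i j v, Y i * Y j * Sum.elim X Y v ∈ N := by
    intro i j v
    by_cases h : (i : ℕ) < a ∧ (j : ℕ) < b - 1
    · rw [hYY i j h.1 h.2]
      rcases v with k | k
      · exact hxxx _ _ _
      · rw [Sum.elim_inr, mul_assoc, hXY, mul_zero]
        exact zero_mem _
    · exact hY i j h v
  rcases u with i | i <;> rcases v with j | j <;> simp only [Sum.elim_inl, Sum.elim_inr]
  · rcases w with k | k
    · exact hxxx i j k
    · rw [Sum.elim_inr, mul_assoc, hXY, mul_zero]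
      exact zero_mem _
  · rw [hXY, zero_mul]
    exact zero_mem _
  · rcases w with k | k
    · by_cases hk : (k : ℕ) < b - 1
      · rw [Sum.elim_inl, mul_assoc, hXX j k hk, ← mul_assoc]
        exact hyyx _ _ (Sum.inr _)
      · exact hX (Sum.inr i) j k hk
    · rw [Sum.elim_inr, mul_assoc, hXY, mul_zero]
      exact zero_mem _
  · exact hyyx i j w

/-- For `d ≥ a (2b - 1)`, where `a + b = n` and `a ≤ b ≤ a + 1`, some algebra has `dim R_3 ≤ n²`:
the letters are split into `a` letters `x_i` and `b` letters `y_j`, with the relations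
`x_i y_j = 0` and `x_i x_j = y_i y_j` for `j < b - 1`. -/
theorem exists_finrank_component_three_le_aux {a b : ℕ} (hab : a ≤ b) (hba : b ≤ a + 1)
    (hb : 0 < b) (hd : a * b + a * (b - 1) ≤ d) :
    ∃ c : Coeffs K (a + b) d, finrank K (component c 3) ≤ (a + b) ^ 2 := by
  let X : Fin a → FreeAlgebra K (Fin (a + b)) := fun i => FreeAlgebra.ι K (Fin.castAdd b i)
  let Y : Fin b → FreeAlgebra K (Fin (a + b)) := fun j => FreeAlgebra.ι K (Fin.natAdd a j)
  have hb1 : b - 1 ≤ a := by omega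
  obtain ⟨c, hc⟩ := exists_coeffs (d := d) (ρ := (Fin a × Fin b) ⊕ (Fin a × Fin (b - 1)))
    (by simpa using hd)
    (Sum.elim (fun t => X t.1 * Y t.2) fun t => X t.1 * X (Fin.castLE hb1 t.2) -
      Y (Fin.castLE hab t.1) * Y (Fin.castLE (Nat.sub_le b 1) t.2)) (by
      rintro (t | t)
      · exact ι_mul_ι_mem _ _
      · exact sub_mem (ι_mul_ι_mem _ _) (ι_mul_ι_mem _ _))
  refine ⟨c, ?_⟩
  set X' : Fin a → QuadraticAlgebra c := fun i => toQuot c (X i) with hX'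
  set Y' : Fin b → QuadraticAlgebra c := fun i => toQuot c (Y i) with hY'
  have hXY : ∀ i j, X' i * Y' j = 0 := fun i j => by
    simpa using hc (Sum.inl (i, j))
  have hXX : ∀ i j : Fin a, (j : ℕ) < b - 1 →
      X' i * X' j = Y' (Fin.castLE hab i) * Y' (Fin.castLE hab j) := fun i j hj => by
    have h := hc (Sum.inr (i, ⟨j, hj⟩))
    rw [Sum.elim_inr, map_sub, sub_eq_zero, map_mul, map_mul] at h
    exact h
  -- The pairs `y_i y_j` outside the relations have `i ≥ a`, or `i < a` and `j = b - 1`.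
  let T : ((Fin (b - a) × Fin b) ⊕ Fin a ⊕ (Fin a × Fin (a + 1 - b))) × (Fin a ⊕ Fin b) →
      QuadraticAlgebra c := fun t => match t with
    | (Sum.inl (i, j), v) => Y' ⟨a + i, by omega⟩ * Y' j * Sum.elim X' Y' v
    | (Sum.inr (Sum.inl i), v) => Y' (Fin.castLE hab i) * Y' ⟨b - 1, by omega⟩ * Sum.elim X' Y' v
    | (Sum.inr (Sum.inr (j, k)), v) => Sum.elim X' Y' v * X' j * X' ⟨b - 1 + k, by omega⟩
  have hcard : Fintype.card (((Fin (b - a) × Fin b) ⊕ Fin a ⊕ (Fin a × Fin (a + 1 - b))) ×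
      (Fin a ⊕ Fin b)) = (a + b) ^ 2 := by
    simp only [Fintype.card_prod, Fintype.card_sum, Fintype.card_fin]
    obtain rfl | rfl : b = a ∨ b = a + 1 := by omega
    · simp; ring
    · simp; ring
  rw [← hcard]
  refine finrank_component_le T fun l hl => ?_
  obtain ⟨i, j, k, rfl⟩ := List.length_eq_three.1 hl
  have hletter : ∀ m : Fin (a + b), ∃ v, toQuot c (FreeAlgebra.ι K m) = Sum.elim X' Y' v := by
    intro m
    refine Fin.addCases (fun i => ⟨Sum.inl i, rfl⟩) (fun j => ⟨Sum.inr j, rfl⟩) m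
  obtain ⟨u, hu⟩ := hletter i
  obtain ⟨v, hv⟩ := hletter j
  obtain ⟨w, hw⟩ := hletter k
  have hword : toQuot c (word K [i, j, k])
      = Sum.elim X' Y' u * Sum.elim X' Y' v * Sum.elim X' Y' w := by
    rw [← hu, ← hv, ← hw]
    simp [word, mul_assoc]
  rw [hword]
  refine mul_mul_mem_of_relations hab hXY hXX (fun i j h v => ?_) (fun v j k h => ?_) hb1 u v w
  · by_cases hi : (i : ℕ) < a
    · refine Submodule.subset_span ⟨(Sum.inr (Sum.inl ⟨i, hi⟩), v), ?_⟩
      have hj : j = ⟨b - 1, by omega⟩ := by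
        apply Fin.ext
        change (j : ℕ) = b - 1
        have := j.2
        have : ¬((j : ℕ) < b - 1) := fun hj => h ⟨hi, hj⟩
        omega
      rw [hj]
      rfl
    · refine Submodule.subset_span ⟨(Sum.inl (⟨i - a, by omega⟩, j), v), ?_⟩
      have hi' : i = ⟨a + (i - a), by omega⟩ := Fin.ext (by simp; omega)
      conv_rhs => rw [hi']
  · refine Submodule.subset_span ⟨(Sum.inr (Sum.inr (j, ⟨k - (b - 1), by omega⟩)), v), ?_⟩
    have hk' : k = ⟨b - 1 + (k - (b - 1)), by omega⟩ := Fin.ext (by simp; omega)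
    conv_rhs => rw [hk']

theorem exists_finrank_component_three_le (hn : 0 < n) :
    ∃ c : Coeffs K n (n * (n - 1) / 2), finrank K (component c 3) ≤ n ^ 2 := by
  have hd := two_mul_choose_two n
  obtain ⟨m, rfl | rfl⟩ := Nat.even_or_odd' n
  · have hm : 0 < m := by omega
    have h := exists_finrank_component_three_le_aux (K := K) (a := m) (b := m)
      (d := 2 * m * (2 * m - 1) / 2) le_rfl (by omega) hm (by
        obtain ⟨k, rfl⟩ : ∃ k, m = k + 1 := ⟨m - 1, by omega⟩
        rw [Nat.add_sub_cancel]
        nlinarith)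
    rwa [← two_mul] at h
  · have h := exists_finrank_component_three_le_aux (K := K) (a := m) (b := m + 1)
      (d := (2 * m + 1) * (2 * m + 1 - 1) / 2) (by omega) le_rfl (by omega) (by
        rw [Nat.add_sub_cancel]
        nlinarith)
    rwa [← add_assoc, ← two_mul] at h

/-! ### Three letters -/

set_option maxHeartbeats 1000000 in
/-- If `zy = -xz`, `xy = 0` and `zz = xx - yy`, then all products of five letters vanish. -/
theorem prod_five_eq_zero {R : Type*} [Ring R] (h2 : ∀ a : R, 2 * a = 0 → a = 0) {X Y Z : R}
    (hzy : Z * Y = -(X * Z)) (hxy : X * Y = 0) (hzz : Z * Z = X * X - Y * Y)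
    (a b c d e : Fin 3) :
    ![X, Y, Z] a * (![X, Y, Z] b * (![X, Y, Z] c * (![X, Y, Z] d * ![X, Y, Z] e))) = 0 := by
  -- The elements `e4`, …, `f9` of a Gröbner basis (`x < y < z`, except that `yyxx` is rewritten
  -- in terms of `yyyy`) come from overlaps of the leading words of the previous ones.
  have e4 : Z * (X * Z) = Y * (Y * Y) := by
    linear_combination (norm := noncomm_ring) Z * hzy - hzz * Y - X * hxy
  have e5 : Z * (X * X) = X * (X * Z) + X * (X * Z) - Y * (Y * Z) := by
    linear_combination (norm := noncomm_ring) hzz * Z - Z * hzz + hzy * Y - X * hzy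
  have e6 : Y * (Y * (X * Z)) = X * (X * (X * Z)) + X * (X * (X * Z)) := by
    linear_combination (norm := noncomm_ring)
      Y * Y * hzy - 2 * X * X * hzy - e5 * Y + Z * X * hxy
  have e7 : Y * (Y * (X * X)) =
      Y * (Y * (Y * Y)) + Y * (Y * (Y * Y)) + (X * (X * (X * X)) + X * (X * (X * X))) := by
    linear_combination (norm := noncomm_ring)
      e5 * Z - Z * X * hzy + e4 * Y + 2 * X * X * hzz - 2 * X * hxy * Y - Y * Y * hzz
  have e8 : Y * (Y * (Z * X)) = X * (X * (Z * X)) + X * (X * (Z * X)) - Y * (Y * (Y * Z)) := by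
    linear_combination (norm := noncomm_ring) e5 * X - e4 * Z - Z * hxy * Y + Z * X * hzz
  have f1 : X * (X * (X * (X * Z))) = 0 := h2 _ <| by
    linear_combination (norm := noncomm_ring) hxy * (Y * X * Z) - X * e6
  have f2 : X * (X * (X * (X * X))) = 0 := h2 _ <| by
    linear_combination (norm := noncomm_ring)
      hxy * (Y * X * X) - 2 * hxy * (Y * Y * Y) - X * e7
  have f3 : X * (X * (X * (Z * X))) = 0 := h2 _ <| by
    linear_combination (norm := noncomm_ring) hxy * (Y * Z * X) + hxy * (Y * Y * Z) - X * e8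
  have f4 : Y * (Y * (Y * (Y * Y))) = 0 := h2 _ <| by
    linear_combination (norm := noncomm_ring) Y * Y * X * hxy - 2 * X * X * X * hxy - e7 * Y
  have f5 : Y * (Y * (Y * (Y * Z))) = 0 := h2 _ <| by
    linear_combination (norm := noncomm_ring)
      Y * Y * X * hzy - e6 * Y - 2 * X * X * X * hzy - e7 * Z
  have f6 : Y * (Y * (Y * (Y * X))) = 0 := h2 _ <| by
    linear_combination (norm := noncomm_ring) e6 * Z + 2 * X * X * X * hzz
      - 2 * X * X * hxy * Y + Y * Y * hxy * Y - Y * Y * X * hzz - e7 * X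
  have f7 : Y * (X * (X * (X * Z))) = 0 := h2 _ <| by
    linear_combination (norm := noncomm_ring)
      Y * Y * Y * hzy - e8 * Y + Y * Y * Z * hxy - 2 * X * X * Z * hxy - Y * e6
  have f8 : Y * (X * (X * (X * X))) = 0 := h2 _ <| by
    linear_combination (norm := noncomm_ring) e8 * Z - Y * Y * e4 + 2 * X * X * e4
      + 2 * X * hxy * (Y * Y) - Y * Y * Y * hzz - Y * e7 - 2 * f4
  have f9 : Y * (X * (X * (Z * X))) = 0 := h2 _ <| by
    linear_combination (norm := noncomm_ring) e8 * X - Y * e8 - Y * Y * e5 - 2 * e7 * Z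
      + 2 * X * X * e5 - 2 * X * hxy * (Y * Z) - 2 * f5
  -- The rewriting rules inside a right-associated product.
  have r1 : ∀ t, Z * (Y * t) = -(X * (Z * t)) := fun t => by
    simpa only [mul_assoc, neg_mul] using congrArg (· * t) hzy
  have r2 : ∀ t, X * (Y * t) = 0 := fun t => by rw [← mul_assoc, hxy, zero_mul]
  have r3 : ∀ t, Z * (Z * t) = X * (X * t) - Y * (Y * t) := fun t => by
    simpa only [mul_assoc, sub_mul] using congrArg (· * t) hzz
  have r4 : ∀ t, Z * (X * (Z * t)) = Y * (Y * (Y * t)) := fun t => by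
    simpa only [mul_assoc] using congrArg (· * t) e4
  have r5 : ∀ t, Z * (X * (X * t)) = X * (X * (Z * t)) + X * (X * (Z * t)) - Y * (Y * (Z * t)) :=
    fun t => by simpa only [mul_assoc, sub_mul, add_mul] using congrArg (· * t) e5
  have r6 : ∀ t, Y * (Y * (X * (Z * t))) = X * (X * (X * (Z * t))) + X * (X * (X * (Z * t))) :=
    fun t => by simpa only [mul_assoc, add_mul] using congrArg (· * t) e6
  have r7 : ∀ t, Y * (Y * (X * (X * t))) =
      Y * (Y * (Y * (Y * t))) + Y * (Y * (Y * (Y * t)))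
        + (X * (X * (X * (X * t))) + X * (X * (X * (X * t)))) :=
    fun t => by simpa only [mul_assoc, add_mul] using congrArg (· * t) e7
  have r8 : ∀ t, Y * (Y * (Z * (X * t))) =
      X * (X * (Z * (X * t))) + X * (X * (Z * (X * t))) - Y * (Y * (Y * (Z * t))) :=
    fun t => by simpa only [mul_assoc, sub_mul, add_mul] using congrArg (· * t) e8
  fin_cases a <;> fin_cases b <;> fin_cases c <;> fin_cases d <;> fin_cases e <;>
    simp [mul_add, mul_sub, hzy, hxy, hzz, e4, e5, e6, e7, e8, f1, f2, f3, f4, f5, f6, f7, f8, f9,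
      r1, r2, r3, r4, r5, r6, r7]

/-- Three relations in three letters for which `R_5 = 0`:
`x₂x₁ = -x₀x₂`, `x₀x₁ = 0`, `x₂² = x₀² - x₁²`. -/
theorem exists_finrank_component_five_three [CharZero K] :
    ∃ c : Coeffs K 3 3, finrank K (component c 5) ≤ 0 := by
  let x : Fin 3 → FreeAlgebra K (Fin 3) := FreeAlgebra.ι K
  obtain ⟨c, hc⟩ := exists_coeffs (n := 3) (d := 3) (ρ := Fin 3) (by simp)
    ![x 2 * x 1 + x 0 * x 2, x 0 * x 1, x 2 * x 2 - (x 0 * x 0 - x 1 * x 1)] (by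
      have h : ∀ k m, x k * x m ∈ freeComponent K 3 2 := ι_mul_ι_mem
      intro t
      fin_cases t
      · exact add_mem (h _ _) (h _ _)
      · exact h _ _
      · exact sub_mem (h _ _) (sub_mem (h _ _) (h _ _)))
  refine ⟨c, (finrank_component_le (τ := Empty) (fun t => t.elim) fun l hl => ?_).trans (by simp)⟩
  have h0 := hc 0
  have h1 := hc 1
  have h2 := hc 2
  simp only [Matrix.cons_val, map_add, map_sub, map_mul] at h0 h1 h2
  have htwo : ∀ a : QuadraticAlgebra c, 2 * a = 0 → a = 0 := fun a ha => by
    have h : (2 : K) • a = 0 := by rw [two_smul, ← two_mul, ha]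
    exact (smul_eq_zero.1 h).resolve_left two_ne_zero
  have hx : ∀ i, toQuot c (x i) = ![toQuot c (x 0), toQuot c (x 1), toQuot c (x 2)] i := by
    intro i; fin_cases i <;> rfl
  match l, hl with
  | [i, j, k, r, s], _ =>
    have h := prod_five_eq_zero htwo (eq_neg_of_add_eq_zero_left h0) h1 (sub_eq_zero.1 h2) i j k r s
    simp only [← hx] at h
    have hw : toQuot c (word K [i, j, k, r, s]) = 0 := by
      rw [← h]
      simp [word, x]
    rw [hw]
    exact zero_mem _

/-! ### Four letters -/

/-- Six semigroup relations in four letters for which `R_4` is spanned by four words. -/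
def fourLetterRels : List SemigroupRel :=
  [((3, 2), some (2, 1)), ((1, 1), some (3, 0)), ((0, 1), some (1, 3)), ((0, 0), some (2, 2)),
   ((3, 1), some (2, 0)), ((0, 2), some (3, 3))]

/-- Six semigroup relations in four letters for which `R_5 = 0`. -/
def fourLetterNilpotentRels : List SemigroupRel :=
  [((3, 0), some (1, 2)), ((3, 3), some (0, 2)), ((0, 0), some (1, 1)), ((3, 1), some (2, 2)),
   ((0, 1), none), ((1, 3), some (3, 2))]

theorem exists_finrank_component_four_four :
    ∃ c : Coeffs K 4 6, finrank K (component c 4) ≤ 4 :=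
  exists_finrank_component_le (p := 4) (s := fun _ => 1) (rels := fourLetterRels)
    (S := [[1, 2, 3, 0], [1, 2, 3, 3], [2, 1, 2, 3], [1, 2, 2, 3]])
    (by decide +kernel) (by unfold LettersLT; decide) (by decide) rfl (by decide)

theorem exists_finrank_component_five_four :
    ∃ c : Coeffs K 4 6, finrank K (component c 5) ≤ 0 :=
  exists_finrank_component_le (p := 4) (s := fun _ => 1) (rels := fourLetterNilpotentRels)
    (S := []) (by decide +kernel) (by unfold LettersLT; decide) (by simp) rfl (by decide)

/-! ### At least five letters -/

/-- Fifteen semigroup relations in six letters for which `R_4 = 0`. Only ten of them remain when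
the letter `5` is deleted, and only four when just the letters `1`, `3`, `4` are kept. -/
def sixLetterRels : List SemigroupRel :=
  [((0, 1), some (2, 3)), ((4, 0), some (3, 2)), ((4, 2), some (1, 0)), ((4, 4), some (1, 3)),
   ((4, 3), none), ((2, 2), some (0, 0)), ((1, 1), some (2, 1)), ((0, 1), some (2, 4)),
   ((0, 3), some (2, 0)), ((4, 1), some (3, 3)), ((5, 1), some (2, 5)), ((5, 4), some (0, 5)),
   ((1, 5), some (5, 0)), ((5, 5), some (3, 5)), ((5, 3), some (4, 5))]

/-- The blow-ups of the presentation in six letters; the search over its `6⁴` words is evaluated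
here, once for all sizes. -/
theorem exists_finrank_component_four_of_sizes {n d : ℕ} (s : ℕ → ℕ)
    (hn : ∑ a : Fin 6, s a = n) (hd : (sixLetterRels.map (relCost s)).sum ≤ d) :
    ∃ c : Coeffs K n d, finrank K (component c 4) ≤ 0 :=
  exists_finrank_component_le (p := 6) (s := s) (rels := sixLetterRels) (S := [])
    (by decide +kernel) (by unfold LettersLT; decide) (by simp) hn hd

theorem exists_finrank_component_four_le {n : ℕ} (hn : 5 ≤ n) :
    ∃ c : Coeffs K n (n * (n - 1) / 2), finrank K (component c 4) ≤ 0 := by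
  by_cases hsmall : n ∈ [5, 6, 7, 8, 10, 11, 13, 16]
  · simp only [List.mem_cons, List.not_mem_nil, or_false] at hsmall
    -- `n` letters for which the blow-up has at most `n(n-1)/2` relations.
    let s (l : List ℕ) : ℕ → ℕ := fun a => l.getD a 0
    rcases hsmall with rfl | rfl | rfl | rfl | rfl | rfl | rfl | rfl
    · exact exists_finrank_component_four_of_sizes (s [1, 1, 1, 1, 1, 0]) rfl (by decide)
    · exact exists_finrank_component_four_of_sizes (s [1, 1, 1, 1, 1, 1]) rfl (by decide)
    · exact exists_finrank_component_four_of_sizes (s [2, 1, 2, 1, 1, 0]) rfl (by decide)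
    · exact exists_finrank_component_four_of_sizes (s [1, 2, 1, 2, 2, 0]) rfl (by decide)
    · exact exists_finrank_component_four_of_sizes (s [2, 2, 2, 2, 2, 0]) rfl (by decide)
    · exact exists_finrank_component_four_of_sizes (s [1, 3, 1, 3, 3, 0]) rfl (by decide)
    · exact exists_finrank_component_four_of_sizes (s [1, 3, 1, 4, 4, 0]) rfl (by decide)
    · exact exists_finrank_component_four_of_sizes (s [2, 3, 2, 3, 3, 3]) rfl (by decide)
  · have hd := two_mul_choose_two n
    simp only [List.mem_cons, List.not_mem_nil, or_false, not_or] at hsmall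
    -- The letters are distributed evenly among `1`, `3` and `4`, so that about `4n²/9` relations
    -- suffice.
    obtain ⟨k, hk⟩ : ∃ k, n = 3 * k ∨ n = 3 * k + 1 ∨ n = 3 * k + 2 := ⟨n / 3, by omega⟩
    rcases hk with rfl | rfl | rfl
    · refine exists_finrank_component_four_of_sizes (fun a => [0, k, 0, k, k, 0].getD a 0)
        (by simp [Fin.sum_univ_succ]; ring) ?_
      have h3 : 3 ≤ k := by omega
      simp [sixLetterRels, relCost]
      nlinarith
    · refine exists_finrank_component_four_of_sizes (fun a => [0, k, 0, k, k + 1, 0].getD a 0)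
        (by simp [Fin.sum_univ_succ]; ring) ?_
      have h3 : 6 ≤ k := by omega
      simp [sixLetterRels, relCost]
      rw [Nat.le_div_iff_mul_le two_pos]
      nlinarith
    · refine exists_finrank_component_four_of_sizes (fun a => [0, k, 0, k + 1, k + 1, 0].getD a 0)
        (by simp [Fin.sum_univ_succ]; ring) ?_
      have h3 : 4 ≤ k := by omega
      simp [sixLetterRels, relCost]
      rw [Nat.le_div_iff_mul_le two_pos]
      nlinarith

/-! ### The generic Hilbert series -/

/-- If `R_3` is minimal, then the dimensions below degree four are the generic ones. -/
theorem finrank_component_lt_four {K : Type*} [Field K] {n : ℕ} (hn : 0 < n)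
    {c : Coeffs K n (n * (n - 1) / 2)} (h3 : finrank K (component c 3) ≤ n ^ 2) :
    finrank K (component c 0) = 1 ∧ finrank K (component c 1) = n ∧
      finrank K (component c 2) = n * (n + 1) / 2 ∧ finrank K (component c 3) = n ^ 2 :=
  ⟨by simp [finrank_component_of_lt_two], by simp [finrank_component_of_lt_two],
    finrank_component_two_three hn h3⟩

end QuadAlg

end

open QuadAlg Module in
theorem theorem2 (K : Type*) [Field K] [CharZero K] (n : ℕ) (hn : 3 ≤ n) :
    QuadAlg.Generic K n (n * (n - 1) / 2) (fun c =>
      Module.Finite K (QuadAlg.QuadraticAlgebra c) ∧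
      (5 ≤ n →
        QuadAlg.hilbertSeries c =
          1 + (n : PowerSeries ℤ) * PowerSeries.X
            + ((n * (n + 1) / 2 : ℕ) : PowerSeries ℤ) * PowerSeries.X ^ 2
            + (n : PowerSeries ℤ) ^ 2 * PowerSeries.X ^ 3 ∧
        Module.finrank K (QuadAlg.QuadraticAlgebra c) = (3 * n * (n + 1) + 2) / 2) ∧
      (n = 4 →
        QuadAlg.hilbertSeries c =
          1 + 4 * PowerSeries.X + 10 * PowerSeries.X ^ 2 + 16 * PowerSeries.X ^ 3
            + 4 * PowerSeries.X ^ 4 ∧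
        Module.finrank K (QuadAlg.QuadraticAlgebra c) = 35) ∧
      (n = 3 →
        QuadAlg.hilbertSeries c =
          1 + 3 * PowerSeries.X + 6 * PowerSeries.X ^ 2 + 9 * PowerSeries.X ^ 3
            + 9 * PowerSeries.X ^ 4 ∧
        Module.finrank K (QuadAlg.QuadraticAlgebra c) = 28)) := by
  obtain ⟨c₃, hc₃⟩ := exists_finrank_component_three_le (K := K) (n := n) (by omega)
  obtain ⟨p, hp, h3⟩ := exists_polynomial_finrank_component_le c₃ 3
  obtain rfl | rfl | h5 : n = 3 ∨ n = 4 ∨ 5 ≤ n := by omega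
  · obtain ⟨c₅, hc₅⟩ := exists_finrank_component_five_three (K := K)
    obtain ⟨p', hp', h5⟩ := exists_polynomial_finrank_component_le c₅ 5
    refine generic_of_polynomial (p * p') (mul_ne_zero hp hp') fun c hc => ?_
    rw [map_mul] at hc
    obtain ⟨d0, d1, d2, d3⟩ := finrank_component_lt_four (by norm_num)
      ((h3 c (left_ne_zero_of_mul hc)).trans hc₃)
    have hbot := component_eq_bot_of_finrank ((h5 c (right_ne_zero_of_mul hc)).trans hc₅)
    have d5 := finrank_component_eq_zero_of_le hbot le_rfl
    -- The inequality in degrees 4 and 5 bounds `dim R_4` from below and from above.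
    have d4 : finrank K (component c 4) = 9 := by
      have g2 := golod_shafarevich c 2
      have g3 := golod_shafarevich c 3
      simp only [Nat.reduceAdd] at g2 g3
      rw [d2, d3] at g2
      rw [d3, d5] at g3
      omega
    refine ⟨finite_of_component_eq_bot hbot, fun h => absurd h (by norm_num),
      fun h => absurd h (by norm_num), fun _ => ⟨?_, ?_⟩⟩
    · rw [hilbertSeries_eq_of_bot hbot]
      simp [Finset.sum_range_succ, d0, d1, d2, d3, d4]
    · rw [finrank_eq_sum hbot]
      simp [Finset.sum_range_succ, d0, d1, d2, d3, d4]
  · obtain ⟨c₄, hc₄⟩ := exists_finrank_component_four_four (K := K)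
    obtain ⟨c₅, hc₅⟩ := exists_finrank_component_five_four (K := K)
    obtain ⟨p', hp', h4⟩ := exists_polynomial_finrank_component_le c₄ 4
    obtain ⟨p'', hp'', h5⟩ := exists_polynomial_finrank_component_le c₅ 5
    refine generic_of_polynomial (p * (p' * p'')) (mul_ne_zero hp (mul_ne_zero hp' hp''))
      fun c hc => ?_
    rw [map_mul, map_mul] at hc
    have hc' := right_ne_zero_of_mul hc
    obtain ⟨d0, d1, d2, d3⟩ := finrank_component_lt_four (by norm_num)
      ((h3 c (left_ne_zero_of_mul hc)).trans hc₃)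
    have hbot := component_eq_bot_of_finrank ((h5 c (right_ne_zero_of_mul hc')).trans hc₅)
    have d4 : finrank K (component c 4) = 4 := by
      have g2 := golod_shafarevich c 2
      simp only [Nat.reduceAdd] at g2
      rw [d2, d3] at g2
      have := (h4 c (left_ne_zero_of_mul hc')).trans hc₄
      omega
    refine ⟨finite_of_component_eq_bot hbot, fun h => absurd h (by norm_num),
      fun _ => ⟨?_, ?_⟩, fun h => absurd h (by norm_num)⟩
    · rw [hilbertSeries_eq_of_bot hbot]
      simp [Finset.sum_range_succ, d0, d1, d2, d3, d4]
    · rw [finrank_eq_sum hbot]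
      simp [Finset.sum_range_succ, d0, d1, d2, d3, d4]
  · obtain ⟨c₄, hc₄⟩ := exists_finrank_component_four_le (K := K) h5
    obtain ⟨p', hp', h4⟩ := exists_polynomial_finrank_component_le c₄ 4
    refine generic_of_polynomial (p * p') (mul_ne_zero hp hp') fun c hc => ?_
    rw [map_mul] at hc
    obtain ⟨d0, d1, d2, d3⟩ := finrank_component_lt_four (by omega)
      ((h3 c (left_ne_zero_of_mul hc)).trans hc₃)
    have hbot := component_eq_bot_of_finrank ((h4 c (right_ne_zero_of_mul hc)).trans hc₄)
    refine ⟨finite_of_component_eq_bot hbot, fun _ => ⟨?_, ?_⟩, fun h => by omega,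
      fun h => by omega⟩
    · rw [hilbertSeries_eq_of_bot hbot]
      simp [Finset.sum_range_succ, d0, d1, d2, d3]
    · rw [finrank_eq_sum hbot]
      simp only [Finset.sum_range_succ, Finset.sum_range_zero, d0, d1, d2, d3]
      obtain ⟨m, hm⟩ := (Nat.even_mul_succ_self n).two_dvd
      have h1 : 3 * n * (n + 1) + 2 = 2 * (3 * m + 1) := by rw [mul_assoc, hm]; ring
      rw [hm, h1, Nat.mul_div_cancel_left _ two_pos, Nat.mul_div_cancel_left _ two_pos]
      nlinarith
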